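/- **Theorem (Weak Separators for $k$-Path Separable Graphs).** For every $c>0$ there is a constant $C=C(c)$ such that for all integers $n,k\ge 0$ and all reals $\mathcal D\ge 0$, $\epsilon>0$ there is a randomized distributed algorithm (with access to $n,k,\mathcal D,\epsilon$ only) that uses at most $$C\cdot\max\{1,\ \epsilon^{-1}k\log n\}$$ minor aggregations on messages of at most $C\log n$ bits, and at most $C\cdot\max\{1,\epsilon^{-1}k\log n\}$ $2$-approximate set-source shortest path computations, with the following guarantee. On every $n$-node weighted $k$-path separable graph $G=(V,E,\ell)$, $\ell\ge 0$, with weighted diameter smaller than $\mathcal D$, and however the (correct) answers to the shortest path computations are chosen, even adaptively to the past of the execution, the algorithm outputs with probability at least $1-n^{-c}$ a weak $\kappa$-path $(\mathcal D,\epsilon)$-separator of $G$ for some $\kappa\le C\cdot\max\{1,\epsilon^{-1}k\log n\}$. Here the notions are as follows. *Weak separator.* A weak $\kappa$-path $(\mathcal D,\epsilon)$-separator is a sequence $S=((P_1,B_1),\dots,(P_\kappa,B_\kappa))$ such that, with $G_i:=G\setminus\bigcup_{j\le i}(P_j\cup B_j)$: (1) each $P_i$ is a $2$-approximate shortest path of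 $G_{i-1}$ of length at most $4\mathcal D$; (2) each $B_i$ is a set of nodes at distance at most $\epsilon\mathcal D$ from $P_i$ in $G$; (3) $|B_{G_\kappa}(v,\mathcal D)|\le \frac78 n$ for every node $v$ of $G_\kappa$, where $B_{G_\kappa}(v,\mathcal D)$ is the set of nodes at distance at most $\mathcal D$ from $v$ in $G_\kappa$. *Path separability.* A weighted graph $H$ with $m$ nodes is $k$-path separable if there are finite sets $\mathcal P_0,\mathcal P_1,\dots$ of paths, at most $k$ paths in total, such that the paths of $\mathcal P_i$ are shortest paths in $H\setminus\bigcup_{j<i}\mathcal P_j$, every connected component of $H'=H\setminus\bigcup_j\mathcal P_j$ has at most $m/2$ nodes, and $H'$ is empty or, recursively, $k$-path separable (a recursion that ends after finitely many steps). *Model.* The nodes are the identifiers $0,\dots,n-1$; initially a node knows its identifier, its neighbours and the lengths of its incident edges. Local computation and independent private random bits are free. In a minor aggregation, the nodes designate a subgraph of $G$ (each node decides from its own state whether it takes part and which incident edges it marks); every node contributes a message and learns the aggregate, under a commutative and associative operation, of the messages in its connected component of that subgraph. In a $2$-approximate set-source shortest path computation, the nodes designate a subgraph $H$ of $G$ and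 a source set $S$; every node $v$ that can reach $S$ in $H$ learns a predecessor (none if $v\in S$) and a distance such that following the predecessors from $v$ gives a path in $H$ to $S$ whose length is that distance and is at most $2\,d_H(v,S)$; a node that cannot reach $S$ learns just this. At the end every node knows, for each $i\le\kappa$, whether it lies on $P_i$, its predecessor on $P_i$, and whether it belongs to $B_i$. -/

import Mathlib

open scoped NNReal ENNReal

noncomputable section

namespace WeakSep

/-! ## Weighted graphs -/

section Graphs

variable {V : Type*}

/-- The weighted length of a walk, for edge lengths `ℓ`. -/
def wlen {H : SimpleGraph V} (ℓ : Sym2 V → ℝ≥0) {u v : V} (p : H.Walk u v) : ℝ≥0 :=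
  (p.edges.map ℓ).sum

/-- The weighted distance `d_H(u, v)`; it is `⊤` if `v` cannot be reached from `u` in `H`. -/
def gdist (H : SimpleGraph V) (ℓ : Sym2 V → ℝ≥0) (u v : V) : ℝ≥0∞ :=
  ⨅ p : H.Walk u v, (wlen ℓ p : ℝ≥0∞)

/-- The weighted distance `d_H(v, S)` of a node to a set of nodes (`⊤` if `S` is empty). -/
def setDist (H : SimpleGraph V) (ℓ : Sym2 V → ℝ≥0) (v : V) (S : Finset V) : ℝ≥0∞ :=
  ⨅ s ∈ S, gdist H ℓ v s

/-- The weighted diameter. -/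
def wdiam (G : SimpleGraph V) (ℓ : Sym2 V → ℝ≥0) : ℝ≥0∞ :=
  ⨆ u, ⨆ v, gdist G ℓ u v

/-- The ball `B_H(v, r)`. -/
def gball (H : SimpleGraph V) (ℓ : Sym2 V → ℝ≥0) (v : V) (r : ℝ≥0) : Set V :=
  {w | gdist H ℓ v w ≤ r}

/-- The edges of the subgraph `G[U]` induced by a set `U` of nodes, as a graph on all of `V`.
The nodes outside `U` become isolated, so that a walk of `restrict G U` that starts in `U` is the
same as a walk of `G[U]`. -/
def restrict (G : SimpleGraph V) (U : Finset V) : SimpleGraph V where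
  Adj u v := G.Adj u v ∧ u ∈ U ∧ v ∈ U
  symm := ⟨fun _ _ h => ⟨h.1.symm, h.2.2, h.2.1⟩⟩
  loopless := ⟨fun _ h => h.1.ne rfl⟩

/-- `p` is an `α`-approximate shortest path of `G[U]` (a shortest path, if `α = 1`). -/
structure IsApproxShortestPath (α : ℝ≥0) (G : SimpleGraph V) (ℓ : Sym2 V → ℝ≥0) (U : Finset V)
    {s t : V} (p : G.Walk s t) : Prop where
  isPath : p.IsPath
  inside : ∀ x ∈ p.support, x ∈ U
  short : (wlen ℓ p : ℝ≥0∞) ≤ α * gdist (restrict G U) ℓ s t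

/-- A walk of `G` together with its endpoints. -/
structure GWalk (G : SimpleGraph V) where
  src : V
  dst : V
  walk : G.Walk src dst

variable [DecidableEq V]

/-- The set of nodes of a walk. -/
def GWalk.verts {G : SimpleGraph V} (P : GWalk G) : Finset V :=
  P.walk.support.toFinset

/-! ## `k`-path separable graphs -/

/-- The set of nodes on the paths of one layer `𝒫ᵢ`. -/
def layerVerts {G : SimpleGraph V} (L : List (GWalk G)) : Finset V :=
  (L.flatMap fun P => P.walk.support).toFinset

/-- The nodes of `U` that remain after the removal of all layers `𝒫₀, 𝒫₁, …`. -/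
def layersRest {G : SimpleGraph V} : Finset V → List (List (GWalk G)) → Finset V
  | U, [] => U
  | U, L :: Ls => layersRest (U \ layerVerts L) Ls

/-- Each layer `𝒫ᵢ` consists of shortest paths of `G[U] ∖ ⋃_{j < i} 𝒫ⱼ`. -/
def ShortestLayers {G : SimpleGraph V} (ℓ : Sym2 V → ℝ≥0) :
    Finset V → List (List (GWalk G)) → Prop
  | _, [] => True
  | U, L :: Ls => (∀ P ∈ L, IsApproxShortestPath 1 G ℓ U P.walk) ∧
      ShortestLayers ℓ (U \ layerVerts L) Ls

/-- The layers `Ls` form a `k`-path separator of `G[U]`: they consist of at most `k` paths in total,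
those of each layer are shortest paths after the removal of the previous layers, and after the
removal of all of them every connected component has at most half of the nodes of `U`. -/
structure IsPathSeparator (G : SimpleGraph V) (ℓ : Sym2 V → ℝ≥0) (k : ℕ) (U : Finset V)
    (Ls : List (List (GWalk G))) : Prop where
  shortest : ShortestLayers ℓ U Ls
  card_le : (Ls.map List.length).sum ≤ k
  component : ∀ v ∈ layersRest U Ls,
    2 * {w | w ∈ layersRest U Ls ∧ (restrict G (layersRest U Ls)).Reachable v w}.ncard ≤ U.card

/-- `G[U]` is `k`-path separable: it has a `k`-path separator whose removal leaves the empty graph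
or, recursively, a `k`-path separable graph. -/
inductive IsPathSeparableOn (G : SimpleGraph V) (ℓ : Sym2 V → ℝ≥0) (k : ℕ) : Finset V → Prop
  | last (U : Finset V) (Ls : List (List (GWalk G))) (sep : IsPathSeparator G ℓ k U Ls)
      (rest : layersRest U Ls = ∅) : IsPathSeparableOn G ℓ k U
  | step (U : Finset V) (Ls : List (List (GWalk G))) (sep : IsPathSeparator G ℓ k U Ls)
      (rest : IsPathSeparableOn G ℓ k (layersRest U Ls)) : IsPathSeparableOn G ℓ k U

/-- The weighted graph `(G, ℓ)` is `k`-path separable. -/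
def IsPathSeparable [Fintype V] (G : SimpleGraph V) (ℓ : Sym2 V → ℝ≥0) (k : ℕ) : Prop :=
  IsPathSeparableOn G ℓ k Finset.univ

/-! ## Weak separators -/

/-- A pair `(Pᵢ, Bᵢ)` of a path and a set of nodes around it. -/
structure Piece (G : SimpleGraph V) extends GWalk G where
  ball : Finset V

/-- The nodes of `U` that remain after the removal of all `Pᵢ` and `Bᵢ`. -/
def piecesRest {G : SimpleGraph V} : Finset V → List (Piece G) → Finset V
  | U, [] => U
  | U, P :: Ps => piecesRest (U \ (P.verts ∪ P.ball)) Ps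

/-- Each `Pᵢ` is a `2`-approximate shortest path of length at most `4D` in the graph that is left of
`G[U]` after the removal of the previous pieces, and `Bᵢ ⊆ B_G(Pᵢ, εD)` (distances in `G`). -/
def Carved {G : SimpleGraph V} (ℓ : Sym2 V → ℝ≥0) (D ε : ℝ≥0) : Finset V → List (Piece G) → Prop
  | _, [] => True
  | U, P :: Ps =>
      IsApproxShortestPath 2 G ℓ U P.walk ∧ wlen ℓ P.walk ≤ 4 * D ∧
      (∀ w ∈ P.ball, setDist G ℓ w P.verts ≤ (ε * D : ℝ≥0)) ∧
      Carved ℓ D ε (U \ (P.verts ∪ P.ball)) Ps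

/-- `S = ((P₁, B₁), …, (P_κ, B_κ))` is a weak `κ`-path `(D, ε)`-separator of `(G, ℓ)`, where
`κ = S.length`. -/
structure IsWeakSeparator [Fintype V] {G : SimpleGraph V} (ℓ : Sym2 V → ℝ≥0) (D ε : ℝ≥0)
    (S : List (Piece G)) : Prop where
  carved : Carved ℓ D ε Finset.univ S
  separates : ∀ v ∈ piecesRest Finset.univ S,
    ((gball (restrict G (piecesRest Finset.univ S)) ℓ v D).ncard : ℝ) ≤ 7 / 8 * Fintype.card V

end Graphs

/-! ## The two primitives: approximate set-source shortest paths and minor aggregations -/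

/-- What a node learns from a set-source shortest path computation: its distance to the source set
in the computed tree and its predecessor (the neighbour that is next on the tree path to the source
set). -/
structure SSPResult (n : ℕ) where
  dist : ℝ≥0∞
  pred : Option (Fin n)

/-- `ans` is a correct answer to an `α`-approximate set-source shortest path computation in the
subgraph `H` with source set `S`. From each node that can reach `S`, the predecessors form a path in
`H` to `S`; the node learns the length of that path, which is at most `α · d_H(v, S)`.
A node that cannot reach `S` learns just this. -/
structure IsApproxSSP {n : ℕ} (α : ℝ≥0) (H : SimpleGraph (Fin n)) (ℓ : Sym2 (Fin n) → ℝ≥0)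
    (S : Finset (Fin n)) (ans : Fin n → SSPResult n) : Prop where
  source : ∀ v ∈ S, (ans v).pred = none
  tree : ∀ v, setDist H ℓ v S ≠ ⊤ → ∃ s ∈ S, ∃ p : H.Walk v s,
    (∀ d ∈ p.darts, (ans d.fst).pred = some d.snd) ∧ (ans v).dist = wlen ℓ p
  approx : ∀ v, setDist H ℓ v S ≠ ⊤ → (ans v).dist ≤ α * setDist H ℓ v S
  unreachable : ∀ v, setDist H ℓ v S = ⊤ → (ans v).dist = ⊤ ∧ (ans v).pred = none

/-- Messages and random draws are strings of `b` bits. -/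
abbrev Msg (b : ℕ) := Fin (2 ^ b)

/-- An aggregation function: a commutative and associative operation on `b`-bit messages with a
neutral element. -/
structure AggFun (b : ℕ) where
  op : Msg b → Msg b → Msg b
  unit : Msg b
  comm : ∀ x y, op x y = op y x
  assoc : ∀ x y z, op (op x y) z = op x (op y z)
  unit_op : ∀ x, op unit x = x

open Classical in
/-- The aggregate of the inputs `x` of all nodes in a set. -/
def AggFun.total {n b : ℕ} (F : AggFun b) (A : Set (Fin n)) (x : Fin n → Msg b) : Msg b :=
  haveI : Std.Commutative F.op := ⟨F.comm⟩
  haveI : Std.Associative F.op := ⟨F.assoc⟩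
  Finset.fold F.op F.unit x (Finset.univ.filter (· ∈ A))

/-- How the nodes jointly designate a subgraph of the network: each node decides from its own state
whether it takes part and which of its incident edges it marks. -/
structure SubgraphSpec (n : ℕ) (σ : Type) where
  alive : σ → Bool
  mark : σ → Fin n → Bool

/-- The designated subgraph: the edges of `G` between participating nodes that are marked by an
endpoint. -/
def SubgraphSpec.graph {n : ℕ} {σ : Type} (spec : SubgraphSpec n σ) (G : SimpleGraph (Fin n))
    (s : Fin n → σ) : SimpleGraph (Fin n) where
  Adj u v := G.Adj u v ∧ spec.alive (s u) ∧ spec.alive (s v) ∧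
    (spec.mark (s u) v ∨ spec.mark (s v) u)
  symm := ⟨fun _ _ h => ⟨h.1.symm, h.2.2.1, h.2.1, h.2.2.2.symm⟩⟩
  loopless := ⟨fun _ h => h.1.ne rfl⟩

/-! ## Distributed algorithms over these primitives -/

/-- One instruction, executed by all nodes at the same time; `σ` is the type of states of a node.
* `compute f`: each node draws `b` fair random bits, independently, and updates its own state.
* `aggregate sub input F learn`: a minor aggregation. The connected components of the designated
  subgraph are the minors; each node contributes a `b`-bit input and learns the aggregate of the
  inputs of all nodes in its minor.
* `ssp sub source learn`: a `2`-approximate set-source shortest path computation in the designated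
  subgraph; each node decides from its own state whether it is a source. -/
inductive Instr (n b : ℕ) (σ : Type) : Type
  | compute (f : σ → Msg b → σ)
  | aggregate (sub : SubgraphSpec n σ) (input : σ → Msg b) (F : AggFun b) (learn : σ → Msg b → σ)
  | ssp (sub : SubgraphSpec n σ) (source : σ → Bool) (learn : σ → SSPResult n → σ)

/-- Whether an instruction is a minor aggregation. -/
def Instr.isAggregate {n b : ℕ} {σ : Type} : Instr n b σ → Bool
  | .aggregate .. => true
  | _ => false

/-- Whether an instruction is a shortest path computation. -/
def Instr.isSSP {n b : ℕ} {σ : Type} : Instr n b σ → Bool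
  | .ssp .. => true
  | _ => false

/-- What a node finally knows about one piece `(P, B)`: whether it lies on `P`, its predecessor
on `P` (`none` at the start of `P` and off `P`), and whether it belongs to `B`. -/
structure NodeOutput (n : ℕ) where
  onPath : Bool
  pred : Option (Fin n)
  inBall : Bool

/-- The local view that the node `v` has of a piece. -/
def Piece.view {n : ℕ} {G : SimpleGraph (Fin n)} (P : Piece G) (v : Fin n) : NodeOutput n where
  onPath := decide (v ∈ P.walk.support)
  pred := (P.walk.darts.find? fun d => d.snd = v).map fun d => d.fst
  inBall := decide (v ∈ P.ball)

/-- A distributed algorithm for networks with the node set (and identifiers) `0, …, n - 1`.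
Initially a node knows its identifier, its neighbours and the lengths of its incident edges. -/
structure Algorithm (n b : ℕ) where
  State : Type
  start : Fin n → (Fin n → Option ℝ≥0) → State
  program : List (Instr n b State)
  output : State → List (NodeOutput n)

/-- An adversary that answers the shortest path computations. The answer may depend on everything
that has happened so far (the list of the configurations up to now, the most recent one first), on
the subgraph and on the source set. -/
def Oracle (n : ℕ) (σ : Type) : Type :=
  List (Fin n → σ) → SimpleGraph (Fin n) → Finset (Fin n) → Fin n → SSPResult n

/-- All answers to calls for subgraphs of `G` are correct, with approximation factor `2`. -/
def Oracle.Correct {n : ℕ} {σ : Type} (O : Oracle n σ) (G : SimpleGraph (Fin n))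
    (ℓ : Sym2 (Fin n) → ℝ≥0) : Prop :=
  ∀ hist H S, H ≤ G → IsApproxSSP 2 H ℓ S (O hist H S)

/-- The distribution of the final configuration when a program is run from the configuration `s`,
where `hist` lists the earlier configurations. -/
def exec {n b : ℕ} {σ : Type} (G : SimpleGraph (Fin n)) (O : Oracle n σ) :
    List (Instr n b σ) → List (Fin n → σ) → (Fin n → σ) → PMF (Fin n → σ)
  | [], _, s => PMF.pure s
  | .compute f :: is, hist, s =>
      (PMF.uniformOfFintype (Fin n → Msg b)).bind fun r =>
        exec G O is (s :: hist) fun v => f (s v) (r v)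
  | .aggregate sub input F learn :: is, hist, s =>
      exec G O is (s :: hist) fun v =>
        learn (s v) (F.total {w | (sub.graph G s).Reachable v w} fun w => input (s w))
  | .ssp sub source learn :: is, hist, s =>
      exec G O is (s :: hist) fun v =>
        learn (s v)
          (O (s :: hist) (sub.graph G s) (Finset.univ.filter fun w => source (s w) = true) v)

open Classical in
/-- The initial configuration of an algorithm on the network `(G, ℓ)`. -/
def Algorithm.initial {n b : ℕ} (A : Algorithm n b) (G : SimpleGraph (Fin n))
    (ℓ : Sym2 (Fin n) → ℝ≥0) : Fin n → A.State :=
  fun v => A.start v fun w => if G.Adj v w then some (ℓ s(v, w)) else none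

/-- The distribution of the final configuration of an algorithm on the network `(G, ℓ)`. -/
def Algorithm.run {n b : ℕ} (A : Algorithm n b) (G : SimpleGraph (Fin n))
    (ℓ : Sym2 (Fin n) → ℝ≥0) (O : Oracle n A.State) : PMF (Fin n → A.State) :=
  exec G O A.program [] (A.initial G ℓ)

/-- In the configuration `s`, the nodes' outputs together describe `S`: each node outputs its local
view of each piece of `S`. -/
def Algorithm.Outputs {n b : ℕ} (A : Algorithm n b) {G : SimpleGraph (Fin n)}
    (s : Fin n → A.State) (S : List (Piece G)) : Prop :=
  ∀ v, A.output (s v) = S.map fun P => P.view v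

end WeakSep

end

noncomputable section

namespace WeakSep

/-! ## Weighted walks and distances -/

section Graphs

variable {V : Type*} {H H' G : SimpleGraph V} {ℓ : Sym2 V → ℝ≥0}

/-! Each round draws a uniformly random source and target, connects them inside the remaining graph
`G[U]` by a path of a 2-approximate shortest path tree, and, if the path has length at most `4D`,
removes it together with a neighbourhood of radius about `εD`. What must be shown is that `O(k/ε +
log n)` rounds destroy every ball with more than `7n/8` nodes.

Progress is measured against a fixed top-level `k`-path separator, which is used only in the
analysis. For a separator path `Q`, a shortest path of `G[W]` once the earlier layers are removed,
count the largest `εD/2`-separated set of nodes of `Q` that are relevant: within `4D`, in `G[W ∩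
U]`, of the centre of a `4D`-ball with more than half of all nodes. Two such balls intersect, so the
relevant nodes span at most `16D` along `Q`, and at most `32/ε + 1` of them are separated. Hence
`potential` is at most `33k/ε` for `ε < 1` (`packing_relevant_le`, `potential_le`), and it never
increases.

If a heavy `D`-ball survives, take source and target in it; their tree path has length at most `4D`.
By `exists_decrease`, for all but `n/2` targets this path meets a relevant node of some separator
path: otherwise more than `n/2` targets would share a component with the source after the whole
separator is removed. Removing the neighbourhood of the tree path then lowers the potential. The
source is right with probability at least `7/16`, and then the target with probability at least
`3/16`, as identifiers are drawn from at most `2n` messages.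

Thus `2 ^ potential`, set to `0` when no ball is heavy, shrinks in expectation by the factor `1 -
(7/16)(3/16)(1/2) = 1 - 21/512` per round (`exec_separatorProgram_le`). Each target is drawn after
the tree is fixed, so adaptive answers do no harm. Locally, a node detects that it is on the tree
path by comparing its pointer to the source with its pointer to the target inside the tree
(`mem_treePath_iff`). -/

lemma wlen_nil (u : V) : wlen ℓ (SimpleGraph.Walk.nil : H.Walk u u) = 0 := by simp [wlen]

lemma wlen_cons {u v w : V} (h : H.Adj u v) (p : H.Walk v w) :
    wlen ℓ (.cons h p) = ℓ s(u, v) + wlen ℓ p := by simp [wlen]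

lemma wlen_append {u v w : V} (p : H.Walk u v) (q : H.Walk v w) :
    wlen ℓ (p.append q) = wlen ℓ p + wlen ℓ q := by
  simp [wlen, SimpleGraph.Walk.edges_append]

lemma wlen_reverse {u v : V} (p : H.Walk u v) : wlen ℓ p.reverse = wlen ℓ p := by
  simp [wlen, SimpleGraph.Walk.edges_reverse]

lemma wlen_mapLe (h : H ≤ H') {u v : V} (p : H.Walk u v) : wlen ℓ (p.mapLe h) = wlen ℓ p := by
  simp [wlen]

lemma gdist_le_wlen {u v : V} (p : H.Walk u v) : gdist H ℓ u v ≤ wlen ℓ p := iInf_le _ p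

lemma gdist_self (u : V) : gdist H ℓ u u = 0 := by
  have h := gdist_le_wlen (ℓ := ℓ) (SimpleGraph.Walk.nil : H.Walk u u)
  simpa [wlen_nil] using h

lemma gdist_comm (u v : V) : gdist H ℓ u v = gdist H ℓ v u := by
  have key : ∀ a b : V, gdist H ℓ a b ≤ gdist H ℓ b a := fun a b =>
    le_iInf fun p => (gdist_le_wlen p.reverse).trans (by rw [wlen_reverse])
  exact le_antisymm (key u v) (key v u)

lemma gdist_triangle (u v w : V) : gdist H ℓ u w ≤ gdist H ℓ u v + gdist H ℓ v w := by
  unfold gdist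
  rw [ENNReal.iInf_add]
  refine le_iInf fun p => ?_
  rw [ENNReal.add_iInf]
  refine le_iInf fun q => ?_
  refine (iInf_le _ (p.append q)).trans ?_
  rw [wlen_append, ENNReal.coe_add]

lemma gdist_anti (h : H ≤ H') (u v : V) : gdist H' ℓ u v ≤ gdist H ℓ u v :=
  le_iInf fun p => (gdist_le_wlen (p.mapLe h)).trans (by rw [wlen_mapLe])

lemma reachable_of_gdist_ne_top {u v : V} (h : gdist H ℓ u v ≠ ⊤) : H.Reachable u v := by
  by_contra hr
  apply h
  have : IsEmpty (H.Walk u v) := ⟨fun p => hr ⟨p⟩⟩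
  simp [gdist]

lemma gdist_ne_top {u v : V} (h : H.Reachable u v) : gdist H ℓ u v ≠ ⊤ := by
  obtain ⟨p⟩ := h
  exact ne_top_of_le_ne_top ENNReal.coe_ne_top (gdist_le_wlen p)

lemma gball_anti (h : H ≤ H') (v : V) (r : ℝ≥0) : gball H ℓ v r ⊆ gball H' ℓ v r :=
  fun w hw => (gdist_anti h v w).trans hw

lemma setDist_le {v s : V} {S : Finset V} (hs : s ∈ S) : setDist H ℓ v S ≤ gdist H ℓ v s :=
  iInf₂_le s hs

lemma setDist_singleton (v s : V) : setDist H ℓ v {s} = gdist H ℓ v s := by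
  simp [setDist]

lemma setDist_empty (v : V) : setDist H ℓ v ∅ = ⊤ := by
  simp [setDist]

/-! ### Induced subgraphs and positions along shortest paths. -/

lemma restrict_le (U : Finset V) : restrict G U ≤ G := fun _ _ h => h.1

lemma restrict_mono {U W : Finset V} (h : U ⊆ W) : restrict G U ≤ restrict G W :=
  fun _ _ e => ⟨e.1, h e.2.1, h e.2.2⟩

lemma mem_of_restrict_walk {U : Finset V} {u v : V} (p : (restrict G U).Walk u v) (hv : v ∈ U) :
    ∀ x ∈ p.support, x ∈ U := by
  induction p with
  | nil => simpa using hv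
  | cons h p ih =>
    intro x hx
    rw [SimpleGraph.Walk.support_cons, List.mem_cons] at hx
    rcases hx with rfl | hx
    · exact h.2.1
    · exact ih hv x hx

lemma exists_restrict_walk {U : Finset V} {u v : V} (p : G.Walk u v)
    (h : ∀ x ∈ p.support, x ∈ U) :
    ∃ q : (restrict G U).Walk u v, q.support = p.support ∧ wlen ℓ q = wlen ℓ p := by
  induction p with
  | nil => exact ⟨.nil, rfl, by simp [wlen_nil]⟩
  | cons e p ih =>
    obtain ⟨q, hq, hw⟩ := ih fun x hx => h x (by simp [hx])
    have e' : (restrict G U).Adj _ _ :=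
      ⟨e, h _ (SimpleGraph.Walk.start_mem_support _), h _ (by simp)⟩
    exact ⟨.cons e' q, by rw [SimpleGraph.Walk.support_cons, hq, SimpleGraph.Walk.support_cons],
      by rw [wlen_cons, wlen_cons, hw]⟩

lemma gdist_restrict_le {U : Finset V} {u v : V} (p : G.Walk u v)
    (h : ∀ x ∈ p.support, x ∈ U) : gdist (restrict G U) ℓ u v ≤ wlen ℓ p := by
  obtain ⟨q, -, hq⟩ := exists_restrict_walk (ℓ := ℓ) p h
  exact hq ▸ gdist_le_wlen q

lemma gdist_restrict_le_of_mem {U : Finset V} {u v x : V} (p : G.Walk u v)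
    (h : ∀ y ∈ p.support, y ∈ U) (hx : x ∈ p.support) :
    gdist (restrict G U) ℓ x v ≤ wlen ℓ p := by
  classical
  refine (gdist_restrict_le (p.dropUntil x hx) fun y hy =>
    h y (p.support_dropUntil_subset_support hx hy)).trans ?_
  have := congrArg (wlen ℓ) (p.take_spec hx)
  rw [wlen_append] at this
  exact_mod_cast this ▸ le_add_self

/-- Positions of the nodes along a path. -/
lemma exists_positions {a b : V} (p : H.Walk a b) (hp : p.IsPath) :
    ∃ pos : V → ℝ≥0,
      (∀ x ∈ p.support, gdist H ℓ a x ≤ pos x ∧ gdist H ℓ x b + pos x ≤ wlen ℓ p) ∧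
      ∀ x ∈ p.support, ∀ y ∈ p.support, pos x ≤ pos y → gdist H ℓ x y + pos x ≤ pos y := by
  classical
  induction p with
  | nil => exact ⟨fun _ => 0, by simp [gdist_self]⟩
  | @cons a w b e p ih =>
    rw [SimpleGraph.Walk.cons_isPath_iff] at hp
    obtain ⟨pos, h1, h2⟩ := ih hp.1
    have hne : ∀ x ∈ p.support, x ≠ a := fun x hx h => hp.2 (h ▸ hx)
    have ha : ∀ x ∈ p.support, gdist H ℓ a x ≤ ((ℓ s(a, w) + pos x : ℝ≥0) : ℝ≥0∞) := by
      intro x hx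
      refine (gdist_triangle a w x).trans ?_
      rw [ENNReal.coe_add]
      refine add_le_add ?_ (h1 x hx).1
      simpa [wlen_cons, wlen_nil] using gdist_le_wlen (ℓ := ℓ) e.toWalk
    refine ⟨fun x => if x = a then 0 else ℓ s(a, w) + pos x, ?_, ?_⟩
    · intro x hx
      rw [SimpleGraph.Walk.support_cons, List.mem_cons] at hx
      rcases hx with rfl | hx
      · simpa [gdist_self] using gdist_le_wlen (ℓ := ℓ) (SimpleGraph.Walk.cons e p)
      · simp only [hne x hx, if_false]
        refine ⟨ha x hx, ?_⟩
        rw [wlen_cons, ENNReal.coe_add, ENNReal.coe_add, add_left_comm]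
        exact add_le_add le_rfl (h1 x hx).2
    · intro x hx y hy
      rw [SimpleGraph.Walk.support_cons, List.mem_cons] at hx hy
      rcases hx with rfl | hx <;> rcases hy with rfl | hy
      · simp [gdist_self]
      · simp only [hne y hy, if_false, if_true]
        intro _
        simpa using ha y hy
      · simp only [hne x hx, if_false, if_true]
        intro h
        -- The start of the path has position 0, so this order is possible only if all edges up to
        -- `x` have length zero.
        have h0 : ℓ s(y, w) + pos x = 0 := le_antisymm h zero_le
        have := ha x hx
        rw [h0] at this ⊢
        rw [gdist_comm]
        simpa using this
      · simp only [hne x hx, hne y hy, if_false]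
        intro h
        have := h2 x hx y hy (le_of_add_le_add_left h)
        rw [ENNReal.coe_add, ENNReal.coe_add, add_left_comm]
        exact add_le_add le_rfl this

/-- On a shortest path of `G[W]`, distances in `G[W]` dominate differences of positions. -/
lemma exists_positions_of_shortest {W : Finset V} {a b : V} {p : G.Walk a b}
    (hp : IsApproxShortestPath 1 G ℓ W p) :
    ∃ pos : V → ℝ≥0, ∀ x ∈ p.support, ∀ y ∈ p.support, pos x ≤ pos y →
      gdist G ℓ x y + pos x ≤ pos y ∧ pos y ≤ gdist (restrict G W) ℓ x y + pos x := by
  obtain ⟨q, hq, hw⟩ := exists_restrict_walk (ℓ := ℓ) p hp.inside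
  have hqp : q.IsPath := by
    rw [SimpleGraph.Walk.isPath_def, hq, ← SimpleGraph.Walk.isPath_def]
    exact hp.isPath
  obtain ⟨pos, h1, h2⟩ := exists_positions (ℓ := ℓ) q hqp
  rw [hq] at h1 h2
  refine ⟨pos, fun x hx y hy hxy => ⟨?_, ?_⟩⟩
  · exact (add_le_add (gdist_anti (restrict_le W) x y) le_rfl).trans (h2 x hx y hy hxy)
  · have hs := hp.short
    rw [ENNReal.coe_one, one_mul] at hs
    have hyb : gdist (restrict G W) ℓ y b ≠ ⊤ :=
      ne_top_of_le_ne_top ENNReal.coe_ne_top (le_self_add.trans (h1 y hy).2)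
    -- The detour from `a` through `x` and `y` to `b` cannot beat a shortest path; the finite term
    -- `d(y, b)` is then cancelled.
    have := calc
      gdist (restrict G W) ℓ y b + pos y ≤ wlen ℓ q := (h1 y hy).2
      _ ≤ gdist (restrict G W) ℓ a b := hw ▸ hs
      _ ≤ gdist (restrict G W) ℓ a x + (gdist (restrict G W) ℓ x y +
            gdist (restrict G W) ℓ y b) :=
          (gdist_triangle a x b).trans (add_le_add le_rfl (gdist_triangle x y b))
      _ ≤ pos x + (gdist (restrict G W) ℓ x y + gdist (restrict G W) ℓ y b) :=
          add_le_add (h1 x hx).1 le_rfl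
      _ = gdist (restrict G W) ℓ y b + (gdist (restrict G W) ℓ x y + pos x) := by ring
    exact (ENNReal.add_le_add_iff_left hyb).1 this

end Graphs

/-! ## Packings -/

/-- Points of a real interval with pairwise gaps larger than `δ`. -/
lemma card_le_of_gaps {α : Type*} (F : Finset α) (f : α → ℝ) {δ L : ℝ} (hδ : 0 < δ)
    (hgap : ∀ x ∈ F, ∀ y ∈ F, x ≠ y → f x ≤ f y → δ < f y - f x)
    (hdiam : ∀ x ∈ F, ∀ y ∈ F, f y - f x ≤ L) : F.card ≤ ⌊L / δ⌋₊ + 1 := by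
  rcases F.eq_empty_or_nonempty with rfl | hF
  · simp
  obtain ⟨m, hm, hmin⟩ := F.exists_min_image f hF
  rw [← Finset.card_range (⌊L / δ⌋₊ + 1)]
  -- Buckets of width `δ`, starting at the minimum, contain at most one point each.
  refine Finset.card_le_card_of_injOn (fun x => ⌊(f x - f m) / δ⌋₊) ?_ ?_
  · intro x hx
    simp only [Finset.coe_range, Set.mem_Iio]
    exact Nat.lt_succ_of_le (Nat.floor_le_floor
      (div_le_div_of_nonneg_right (hdiam m hm x hx) hδ.le))
  · have key : ∀ x ∈ F, ∀ y ∈ F, x ≠ y → f x ≤ f y →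
        ⌊(f x - f m) / δ⌋₊ ≠ ⌊(f y - f m) / δ⌋₊ := by
      intro x hx y hy hxy hle
      have h1 := hgap x hx y hy hxy hle
      have h0 : 0 ≤ (f x - f m) / δ := div_nonneg (sub_nonneg.2 (hmin x hx)) hδ.le
      apply ne_of_lt
      rw [← Nat.add_one_le_iff, ← Nat.floor_add_one h0]
      apply Nat.floor_le_floor
      rw [div_add_one hδ.ne', div_le_div_iff_of_pos_right hδ]
      linarith
    intro x hx y hy hxy
    by_contra hne
    rcases le_total (f x) (f y) with h | h
    · exact key x hx y hy hne h hxy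
    · exact key y hy x hx (Ne.symm hne) h hxy.symm

section Packing

variable {V : Type*} {G : SimpleGraph V} {ℓ : Sym2 V → ℝ≥0}

/-- The points of `F` have pairwise distance more than `δ` in `G`. -/
def Separated (G : SimpleGraph V) (ℓ : Sym2 V → ℝ≥0) (δ : ℝ≥0) (F : Finset V) : Prop :=
  ∀ x ∈ F, ∀ y ∈ F, x ≠ y → (δ : ℝ≥0∞) < gdist G ℓ x y

open Classical in
/-- The largest size of a `δ`-separated subset. -/
def packing (G : SimpleGraph V) (ℓ : Sym2 V → ℝ≥0) (δ : ℝ≥0) (Y : Finset V) : ℕ :=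
  (Y.powerset.filter (Separated G ℓ δ)).sup Finset.card

lemma packing_le {δ : ℝ≥0} {Y : Finset V} {m : ℕ}
    (h : ∀ F ⊆ Y, Separated G ℓ δ F → F.card ≤ m) : packing G ℓ δ Y ≤ m := by
  classical
  refine Finset.sup_le fun F hF => ?_
  rw [Finset.mem_filter, Finset.mem_powerset] at hF
  exact h F hF.1 hF.2

lemma card_le_packing {δ : ℝ≥0} {Y F : Finset V} (hF : F ⊆ Y) (hs : Separated G ℓ δ F) :
    F.card ≤ packing G ℓ δ Y := by
  classical
  exact Finset.le_sup (f := Finset.card)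
    (Finset.mem_filter.2 ⟨Finset.mem_powerset.2 hF, hs⟩)

lemma packing_mono {δ : ℝ≥0} {Y Y' : Finset V} (h : Y' ⊆ Y) :
    packing G ℓ δ Y' ≤ packing G ℓ δ Y :=
  packing_le fun _ hF hs => card_le_packing (hF.trans h) hs

/-- The node `x` extends every separated subset of `Y'` to a separated subset of `Y`. -/
lemma packing_succ_le {δ : ℝ≥0} {Y Y' : Finset V} (h : Y' ⊆ Y) {x : V} (hx : x ∈ Y)
    (hfar : ∀ y ∈ Y', (δ : ℝ≥0∞) < gdist G ℓ y x) :
    packing G ℓ δ Y' + 1 ≤ packing G ℓ δ Y := by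
  classical
  have hxY : x ∉ Y' := fun hxY => by simpa [gdist_self] using hfar x hxY
  have hpos : 1 ≤ packing G ℓ δ Y := by
    have : Separated G ℓ δ {x} := by simp [Separated]
    simpa using card_le_packing (Finset.singleton_subset_iff.2 hx) this
  suffices packing G ℓ δ Y' ≤ packing G ℓ δ Y - 1 by omega
  refine packing_le fun F hF hs => ?_
  have hins : Separated G ℓ δ (insert x F) := by
    intro a ha b hb hab
    rw [Finset.mem_insert] at ha hb
    rcases ha with rfl | ha <;> rcases hb with rfl | hb
    · exact absurd rfl hab
    · exact gdist_comm b a ▸ hfar b (hF hb)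
    · exact hfar a (hF ha)
    · exact hs a ha b hb hab
  have := card_le_packing (Finset.insert_subset hx (hF.trans h)) hins
  rw [Finset.card_insert_of_notMem fun hxF => hxY (hF hxF)] at this
  omega

end Packing

/-! ## The potential of a set of remaining nodes -/

section Potential

variable {V : Type*} [Fintype V] {G : SimpleGraph V} {ℓ : Sym2 V → ℝ≥0}

/-- The node `x` is close in `G[X]` to the centre of a ball with more than half of all nodes. -/
def Relevant (G : SimpleGraph V) (ℓ : Sym2 V → ℝ≥0) (r : ℝ≥0) (X : Finset V) (x : V) : Prop :=
  x ∈ X ∧ ∃ s, gdist (restrict G X) ℓ x s ≤ r ∧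
    Fintype.card V < 2 * (gball (restrict G X) ℓ s r).ncard

/-- A larger `X` has shorter distances and larger balls. This is what makes the potential monotone
under node removal. -/
lemma Relevant.mono {r : ℝ≥0} {X Y : Finset V} (h : X ⊆ Y) {x : V} (hx : Relevant G ℓ r X x) :
    Relevant G ℓ r Y x := by
  obtain ⟨hxX, s, hs, hb⟩ := hx
  refine ⟨h hxX, s, (gdist_anti (restrict_mono h) x s).trans hs, hb.trans_le ?_⟩
  exact Nat.mul_le_mul_left 2
    (Set.ncard_le_ncard (gball_anti (restrict_mono h) s r) (Set.toFinite _))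

/-- Two balls with more than half of all nodes share a node, which joins the two centres; the route
consists of four legs of length at most `r`. -/
lemma Relevant.gdist_le {r : ℝ≥0} {X : Finset V} {x y : V} (hx : Relevant G ℓ r X x)
    (hy : Relevant G ℓ r X y) : gdist (restrict G X) ℓ x y ≤ (4 * r : ℝ≥0) := by
  obtain ⟨-, s, hs, hbs⟩ := hx
  obtain ⟨-, t, ht, hbt⟩ := hy
  have hne : (gball (restrict G X) ℓ s r ∩ gball (restrict G X) ℓ t r).Nonempty := by
    by_contra hemp
    rw [Set.not_nonempty_iff_eq_empty, ← Set.disjoint_iff_inter_eq_empty] at hemp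
    have h1 := Set.ncard_union_eq hemp (Set.toFinite _) (Set.toFinite _)
    have h2 := Set.ncard_le_ncard (Set.subset_univ
      (gball (restrict G X) ℓ s r ∪ gball (restrict G X) ℓ t r)) (Set.toFinite _)
    rw [Set.ncard_univ, Nat.card_eq_fintype_card] at h2
    omega
  obtain ⟨z, hzs, hzt⟩ := hne
  calc gdist (restrict G X) ℓ x y
      ≤ gdist (restrict G X) ℓ x s + (gdist (restrict G X) ℓ s z +
          (gdist (restrict G X) ℓ z t + gdist (restrict G X) ℓ t y)) :=
        (gdist_triangle x s y).trans (add_le_add le_rfl ((gdist_triangle s z y).trans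
          (add_le_add le_rfl (gdist_triangle z t y))))
    _ ≤ r + (r + (r + r)) := by
        refine add_le_add hs (add_le_add hzs (add_le_add ?_ ?_))
        · rw [gdist_comm]; exact hzt
        · rw [gdist_comm]; exact ht
    _ = (4 * r : ℝ≥0) := by push_cast; ring

variable [DecidableEq V]

open Classical in
/-- The packing numbers of the relevant parts of the separator paths. -/
def potential (ℓ : Sym2 V → ℝ≥0) (r δ : ℝ≥0) :
    Finset V → List (List (GWalk G)) → Finset V → ℕ
  | _, [], _ => 0
  | W, L :: Ls, U =>
    (L.map fun Q => packing G ℓ δ (Q.verts.filter (Relevant G ℓ r (W ∩ U)))).sum +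
      potential ℓ r δ (W \ layerVerts L) Ls U

/-- Two metrics meet here: separation in `G` forces gaps between positions on `Q`, while closeness
in `G[X]`, hence in `G[W]`, where `Q` is shortest, bounds their spread by `4r`. -/
lemma packing_relevant_le {r δ : ℝ≥0} (hδ : 0 < δ) {W X : Finset V} (hX : X ⊆ W) {Q : GWalk G}
    (hQ : IsApproxShortestPath 1 G ℓ W Q.walk) {Y : Finset V}
    (hY : ∀ y ∈ Y, y ∈ Q.verts ∧ Relevant G ℓ r X y) :
    packing G ℓ δ Y ≤ ⌊(4 * r / δ : ℝ)⌋₊ + 1 := by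
  obtain ⟨pos, hpos⟩ := exists_positions_of_shortest hQ
  have hmem : ∀ y ∈ Y, y ∈ Q.walk.support := fun y hy => by
    simpa [GWalk.verts] using (hY y hy).1
  refine packing_le fun F hF hs => ?_
  refine card_le_of_gaps F (fun x => (pos x : ℝ)) (by exact_mod_cast hδ) ?_ ?_
  · intro x hx y hy hxy hle
    have h1 := (hpos x (hmem x (hF hx)) y (hmem y (hF hy)) (by exact_mod_cast hle)).1
    have h2 := (ENNReal.add_lt_add_right ENNReal.coe_ne_top (hs x hx y hy hxy)).trans_le h1
    have h3 : δ + pos x < pos y := by exact_mod_cast h2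
    have h4 : (δ : ℝ) + pos x < pos y := by exact_mod_cast h3
    linarith
  · intro x hx y hy
    rcases le_total (pos y) (pos x) with hle | hle
    · have : (pos y : ℝ) ≤ pos x := by exact_mod_cast hle
      have : (0 : ℝ) ≤ 4 * r := by positivity
      linarith
    have h1 := (hpos x (hmem x (hF hx)) y (hmem y (hF hy)) hle).2
    have h2 := (gdist_anti (restrict_mono hX) x y).trans
      ((hY x (hF hx)).2.gdist_le (hY y (hF hy)).2)
    have h3 : pos y ≤ 4 * r + pos x := by
      exact_mod_cast h1.trans (add_le_add h2 le_rfl)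
    have h4 : (pos y : ℝ) ≤ 4 * r + pos x := by exact_mod_cast h3
    linarith

lemma potential_le {r δ : ℝ≥0} (hδ : 0 < δ) (Ls : List (List (GWalk G))) :
    ∀ (W U : Finset V), ShortestLayers ℓ W Ls →
      potential ℓ r δ W Ls U ≤ (Ls.map List.length).sum * (⌊(4 * r / δ : ℝ)⌋₊ + 1) := by
  classical
  induction Ls with
  | nil => intro W U _; simp [potential]
  | cons L Ls ih =>
    intro W U h
    rw [potential, List.map_cons, List.sum_cons, add_mul]
    refine add_le_add ?_ (ih _ _ h.2)
    have := List.sum_le_card_nsmul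
      (L.map fun Q => packing G ℓ δ (Q.verts.filter (Relevant G ℓ r (W ∩ U))))
      (⌊(4 * r / δ : ℝ)⌋₊ + 1) (by
        intro x hx
        rw [List.mem_map] at hx
        obtain ⟨Q, hQ, rfl⟩ := hx
        exact packing_relevant_le hδ Finset.inter_subset_left (h.1 Q hQ)
          (fun y hy => by simpa using hy))
    simpa using this

lemma layer_mono {r : ℝ≥0} (W : Finset V) {U U' : Finset V} (h : U' ⊆ U)
    (Q : GWalk G) [DecidablePred (Relevant G ℓ r (W ∩ U'))]
    [DecidablePred (Relevant G ℓ r (W ∩ U))] :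
    Q.verts.filter (Relevant G ℓ r (W ∩ U')) ⊆ Q.verts.filter (Relevant G ℓ r (W ∩ U)) := by
  intro x hx
  rw [Finset.mem_filter] at hx ⊢
  exact ⟨hx.1, hx.2.mono (Finset.inter_subset_inter_left h)⟩

lemma potential_mono {r δ : ℝ≥0} (Ls : List (List (GWalk G))) :
    ∀ (W : Finset V) {U U' : Finset V}, U' ⊆ U →
      potential ℓ r δ W Ls U' ≤ potential ℓ r δ W Ls U := by
  classical
  induction Ls with
  | nil => intro W U U' _; simp [potential]
  | cons L Ls ih =>
    intro W U U' h
    rw [potential, potential]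
    exact add_le_add (List.sum_le_sum fun Q _ => packing_mono (layer_mono W h Q)) (ih _ h)

/-- If the sets `R t` are the node sets of short walks to a common node `s`, then all but `n / 2` of
them have a neighbourhood whose removal decreases the potential. -/
lemma exists_decrease {r δ : ℝ≥0} {s : V} {U : Finset V} {R : V → Finset V}
    (Ls : List (List (GWalk G))) :
    ∀ (W A : Finset V),
      (∀ t ∈ A, R t ⊆ W ∩ U ∧ ∃ p : G.Walk t s, p.support.toFinset = R t ∧ wlen ℓ p ≤ r) →
      (∀ v ∈ layersRest W Ls, 2 * {w | w ∈ layersRest W Ls ∧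
        (restrict G (layersRest W Ls)).Reachable v w}.ncard ≤ Fintype.card V) →
      ∃ A' ⊆ A, 2 * A.card ≤ 2 * A'.card + Fintype.card V ∧
        ∀ t ∈ A', ∀ U' ⊆ U, (∀ y ∈ U', ∀ x ∈ R t, (δ : ℝ≥0∞) < gdist G ℓ y x) →
          potential ℓ r δ W Ls U' + 1 ≤ potential ℓ r δ W Ls U := by
  classical
  induction Ls with
  | nil =>
    intro W A hA hcomp
    refine ⟨∅, Finset.empty_subset _, ?_, by simp⟩
    rw [Finset.card_empty, mul_zero, zero_add]
    rcases A.eq_empty_or_nonempty with rfl | ⟨t₀, ht₀⟩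
    · simp
    -- With no layer left, every walk stays in the final remainder, so all of `A` lies in the
    -- component of `s`.
    have hin : ∀ t ∈ A, t ∈ W ∧ s ∈ W ∧ (restrict G W).Reachable s t := by
      intro t ht
      obtain ⟨hR, p, hp, -⟩ := hA t ht
      have hsup : ∀ x ∈ p.support, x ∈ W := fun x hx =>
        (Finset.mem_inter.1 (hR (hp ▸ List.mem_toFinset.2 hx))).1
      obtain ⟨q, -⟩ := exists_restrict_walk (ℓ := ℓ) p hsup
      exact ⟨hsup t p.start_mem_support, hsup s p.end_mem_support, ⟨q.reverse⟩⟩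
    refine le_trans ?_ (hcomp s (hin t₀ ht₀).2.1)
    rw [← Set.ncard_coe_finset A]
    exact Nat.mul_le_mul_left 2 (Set.ncard_le_ncard
      (fun t ht => ⟨(hin t ht).1, (hin t ht).2.2⟩) (Set.toFinite _))
  | cons L Ls ih =>
    intro W A hA hcomp
    -- If at most half of the nodes are left as targets, all may be given up. Otherwise `A` itself
    -- will witness that the ball around `s` is large.
    by_cases hbig : 2 * A.card ≤ Fintype.card V
    · exact ⟨∅, Finset.empty_subset _, by simpa using hbig, by simp⟩
    push Not at hbig
    set A₁ := A.filter fun t => Disjoint (R t) (layerVerts L) with hA₁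
    obtain ⟨A₂, hA₂, hcard, hdec⟩ := ih (W \ layerVerts L) A₁ (by
      intro t ht
      rw [hA₁, Finset.mem_filter] at ht
      refine ⟨fun x hx => ?_, (hA t ht.1).2⟩
      have := Finset.mem_inter.1 ((hA t ht.1).1 hx)
      exact Finset.mem_inter.2
        ⟨Finset.mem_sdiff.2 ⟨this.1, Finset.disjoint_left.1 ht.2 hx⟩, this.2⟩) hcomp
    -- Every target whose walk meets this layer succeeds; the others are deferred to later layers.
    -- The loss of `n / 2` is therefore incurred only once.
    refine ⟨(A \ A₁) ∪ A₂, Finset.union_subset Finset.sdiff_subset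
      (hA₂.trans (Finset.filter_subset _ _)), ?_, ?_⟩
    · rw [Finset.card_union_of_disjoint
        (Finset.disjoint_of_subset_right hA₂ Finset.sdiff_disjoint)]
      have := Finset.card_sdiff_add_card_eq_card (Finset.filter_subset
        (fun t => Disjoint (R t) (layerVerts L)) A)
      rw [← hA₁] at this
      omega
    · intro t ht U' hU' hfar
      rw [potential, potential]
      rw [Finset.mem_union] at ht
      rcases ht with ht | ht
      · rw [Finset.mem_sdiff, hA₁, Finset.mem_filter, not_and] at ht
        have hhit := ht.2 ht.1
        rw [Finset.not_disjoint_iff] at hhit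
        obtain ⟨x, hxR, hxL⟩ := hhit
        rw [layerVerts, List.mem_toFinset, List.mem_flatMap] at hxL
        obtain ⟨Q, hQL, hxQ⟩ := hxL
        obtain ⟨hRt, p, hp, hlen⟩ := hA t ht.1
        -- The `r`-ball around `s` in `G[W ∩ U]` contains `A`, and `x` reaches `s` along the rest of
        -- its walk.
        have hrel : Relevant G ℓ r (W ∩ U) x := by
          refine ⟨hRt hxR, s, ?_, ?_⟩
          · refine (gdist_restrict_le_of_mem p (fun y hy => hRt (hp ▸ List.mem_toFinset.2 hy))
              (List.mem_toFinset.1 (hp ▸ hxR))).trans ?_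
            exact_mod_cast hlen
          · refine hbig.trans_le ?_
            rw [← Set.ncard_coe_finset A]
            refine Nat.mul_le_mul_left 2 (Set.ncard_le_ncard (fun t' ht' => ?_) (Set.toFinite _))
            obtain ⟨hRt', p', hp', hlen'⟩ := hA t' ht'
            change gdist _ _ _ _ ≤ _
            rw [gdist_comm]
            refine (gdist_restrict_le p' fun y hy =>
              hRt' (hp' ▸ List.mem_toFinset.2 hy)).trans ?_
            exact_mod_cast hlen'
        have hlt : (L.map fun Q => packing G ℓ δ
              (Q.verts.filter (Relevant G ℓ r (W ∩ U')))).sum <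
            (L.map fun Q => packing G ℓ δ (Q.verts.filter (Relevant G ℓ r (W ∩ U)))).sum := by
          refine List.sum_lt_sum _ _ (fun Q _ => packing_mono (layer_mono W hU' Q))
            ⟨Q, hQL, ?_⟩
          refine packing_succ_le (layer_mono W hU' Q) (x := x)
            (Finset.mem_filter.2 ⟨by simpa [GWalk.verts] using hxQ, hrel⟩) fun y hy => ?_
          rw [Finset.mem_filter] at hy
          exact hfar y (Finset.mem_inter.1 hy.2.1).2 x hxR
        have := potential_mono (ℓ := ℓ) (r := r) (δ := δ) Ls (W \ layerVerts L) hU'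
        omega
      · have h1 := hdec t ht U' hU' hfar
        have h2 : (L.map fun Q => packing G ℓ δ
              (Q.verts.filter (Relevant G ℓ r (W ∩ U')))).sum ≤
            (L.map fun Q => packing G ℓ δ (Q.verts.filter (Relevant G ℓ r (W ∩ U)))).sum :=
          List.sum_le_sum fun Q _ => packing_mono (layer_mono W hU' Q)
        omega

end Potential

/-! ## Predecessor trees -/

section Follows

variable {V : Type*} {H : SimpleGraph V} {f g : V → Option V}

/-- The walk follows the predecessor pointers `f`. -/
def Follows (f : V → Option V) {u v : V} (p : H.Walk u v) : Prop :=
  ∀ d ∈ p.darts, f d.fst = some d.snd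

lemma follows_cons {u v w : V} {h : H.Adj u v} {p : H.Walk v w} :
    Follows f (.cons h p) ↔ f u = some v ∧ Follows f p := by
  simp [Follows]

/-- Pointers determine each next step, and `f s = none` prevents a walk from continuing beyond `s`.
-/
lemma Follows.support_eq {u s : V} (hs : f s = none) {p q : H.Walk u s} (hp : Follows f p)
    (hq : Follows f q) : p.support = q.support := by
  induction p with
  | nil =>
    cases q with
    | nil => rfl
    | cons h q => rw [follows_cons] at hq; simp [hs] at hq
  | cons h p ih =>
    rw [follows_cons] at hp
    cases q with
    | nil => simp [hs] at hp
    | cons h' q =>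
      rw [follows_cons] at hq
      obtain rfl := Option.some_injective _ (hp.1.symm.trans hq.1)
      rw [SimpleGraph.Walk.support_cons, SimpleGraph.Walk.support_cons, ih hs hp.2 hq.2]

/-- Returning to a node would yield a shorter pointer walk from that node to `s`, against
uniqueness. -/
lemma Follows.isPath {u s : V} (hs : f s = none) {p : H.Walk u s} (hp : Follows f p) :
    p.IsPath := by
  classical
  induction p with
  | nil => exact SimpleGraph.Walk.IsPath.nil
  | @cons u v s h p ih =>
    have hp' := follows_cons.1 hp
    rw [SimpleGraph.Walk.cons_isPath_iff]
    refine ⟨ih hs hp'.2, fun hu => ?_⟩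
    have hd : Follows f (p.dropUntil u hu) := fun d hd =>
      hp'.2 d (p.darts_dropUntil_subset_darts hu hd)
    have h1 := congrArg List.length (Follows.support_eq hs hp hd)
    have h2 := p.length_dropUntil_le_length hu
    simp only [SimpleGraph.Walk.length_support, SimpleGraph.Walk.length_cons] at h1
    omega

/-- If all edges are predecessor edges, every path to the root follows the predecessors. -/
lemma follows_of_isPath (hH : ∀ u v, H.Adj u v → f u = some v ∨ f v = some u) {u s : V}
    (hs : f s = none) {p : H.Walk u s} (hp : p.IsPath) : Follows f p := by
  induction p with
  | nil => simp [Follows]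
  | @cons u v s h p ih =>
    rw [SimpleGraph.Walk.cons_isPath_iff] at hp
    have hp1 := ih hs hp.1
    -- If the first edge were the pointer of `v`, the rest of the path, which follows pointers,
    -- would return to `u`.
    refine follows_cons.2 ⟨(hH u v h).resolve_right fun hv => ?_, hp1⟩
    cases p with
    | nil => simp [hs] at hv
    | cons h' p =>
      obtain rfl := Option.some_injective _ (hv.symm.trans (follows_cons.1 hp1).1)
      exact hp.2 (by simp)

/-- In a tree with pointers `f` to `s` and pointers `g` to `t`, the nodes of the path from `t` to
`s` other than `t` are those at which the pointers differ. -/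
lemma mem_support_iff_pred_ne (hH : ∀ u v, H.Adj u v → f u = some v ∨ f v = some u) {s t v : V}
    (hs : f s = none) (ht : g t = none) {c : H.Walk t s} (hc : Follows f c) {p : H.Walk v s}
    (hp : Follows f p) {q : H.Walk v t} (hq : Follows g q) (hvt : v ≠ t) :
    v ∈ c.support ↔ f v ≠ g v := by
  classical
  have hpp := hp.isPath hs
  have hqp := hq.isPath ht
  cases q with
  | nil => exact absurd rfl hvt
  | @cons _ w _ h q =>
    rw [SimpleGraph.Walk.cons_isPath_iff] at hqp
    have hg : g v = some w := (follows_cons.1 hq).1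
    constructor
    · intro hvc hfg
      rw [hg] at hfg
      cases p with
      | nil => simp [hs] at hfg
      | cons h' p =>
        obtain rfl := Option.some_injective _ (hfg.symm.trans (follows_cons.1 hp).1)
        rw [SimpleGraph.Walk.cons_isPath_iff] at hpp
        -- If both pointers lead from `v` to `w`, the tails of the two walks join `t` to `s` through
        -- `w` and avoid `v`; by uniqueness this gives the path from `t` to `s`.
        set r := (q.reverse.append p).bypass with hr
        have hrf : Follows f r := follows_of_isPath hH hs (SimpleGraph.Walk.bypass_isPath _)
        rw [hc.support_eq hs hrf] at hvc
        have hv := SimpleGraph.Walk.support_bypass_subset_support _ hvc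
        rw [SimpleGraph.Walk.mem_support_append_iff, SimpleGraph.Walk.support_reverse,
          List.mem_reverse] at hv
        exact hv.elim hqp.2 hpp.2
    · intro hfg
      by_contra hvc
      refine hfg ?_
      -- For `v` off the path, stepping to `w`, going on to `t` and then along the path to `s`
      -- contains a path starting with the edge from `v` to `w`; such a path must follow `f`.
      have hpath : (SimpleGraph.Walk.cons h (q.append c).bypass).IsPath := by
        rw [SimpleGraph.Walk.cons_isPath_iff]
        refine ⟨SimpleGraph.Walk.bypass_isPath _, fun hv => ?_⟩
        have hv := SimpleGraph.Walk.support_bypass_subset_support _ hv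
        rw [SimpleGraph.Walk.mem_support_append_iff] at hv
        exact hv.elim hqp.2 hvc
      rw [hg, (follows_cons.1 (follows_of_isPath hH hs hpath)).1]

open Classical in
/-- On the reversed walk, the predecessor of a node is given by `f`. -/
lemma Follows.find_reverse {s t : V} (hs : f s = none) {c : H.Walk t s} (hc : Follows f c)
    (v : V) : (c.reverse.darts.find? fun d => d.snd = v).map (fun d => d.fst) =
      if v ∈ c.support then f v else none := by
  have hdart : ∀ d ∈ c.reverse.darts, f d.snd = some d.fst := by
    intro d hd
    rw [SimpleGraph.Walk.darts_reverse, List.mem_reverse, List.mem_map] at hd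
    obtain ⟨e, he, rfl⟩ := hd
    exact hc e he
  cases hfind : c.reverse.darts.find? fun d => d.snd = v with
  | some d =>
    have h1 : d.snd = v := by simpa using List.find?_some hfind
    have h2 := List.mem_of_find?_eq_some hfind
    have hv : v ∈ c.support := by
      have := c.reverse.dart_snd_mem_support_of_mem_darts h2
      rwa [SimpleGraph.Walk.support_reverse, List.mem_reverse, h1] at this
    rw [if_pos hv, ← h1, hdart d h2, Option.map_some]
  | none =>
    rw [Option.map_none]
    split_ifs with hv
    · rw [List.find?_eq_none] at hfind
      by_cases hvs : v = s
      · rw [hvs, hs]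
      exfalso
      have : v ∈ c.reverse.support := by simpa using hv
      rw [← SimpleGraph.Walk.cons_map_snd_darts, List.mem_cons, List.mem_map] at this
      obtain ⟨d, hd, hdv⟩ := this.resolve_left hvs
      exact hfind d hd (by simpa using hdv)
    · rfl

end Follows

/-! ## Averaging over the bits of one node -/

lemma sum_comp_eval {ι M : Type*} [Fintype ι] [DecidableEq ι] [Fintype M] (z : ι) (h : M → ℝ) :
    ((Fintype.card (ι → M) : ℝ)⁻¹ * ∑ r : ι → M, h (r z)) =
      (Fintype.card M : ℝ)⁻¹ * ∑ m, h m := by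
  rcases isEmpty_or_nonempty M with hM | hM
  · have : IsEmpty (ι → M) := ⟨fun r => hM.elim (r z)⟩
    simp
  have hsum : ∑ r : ι → M, h (r z) =
      (Fintype.card ({j // j ≠ z} → M) : ℝ) * ∑ m, h m := by
    rw [Fintype.sum_equiv (Equiv.funSplitAt z M) (fun r => h (r z)) (fun x => h x.1)
      (fun r => rfl), Fintype.sum_prod_type, Finset.mul_sum]
    simp
  have hcard : Fintype.card (ι → M) = Fintype.card M * Fintype.card ({j // j ≠ z} → M) := by
    rw [Fintype.card_congr (Equiv.funSplitAt z M), Fintype.card_prod]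
  have h0 : (Fintype.card ({j // j ≠ z} → M) : ℝ) ≠ 0 := by
    exact_mod_cast Fintype.card_ne_zero
  rw [hsum, hcard, Nat.cast_mul, mul_inv]
  field_simp

/-- The one-step estimate for the failure probability: it is at most `K` always and at most `x * K`
on an event of probability at least `β` that depends on the bits of `z` alone. The choice `β = 0`,
`A = ∅` is allowed and gives `K`. -/
lemma tsum_uniform_le {n b : ℕ} (z : Fin n) (g : (Fin n → Msg b) → ℝ≥0∞) (A : Finset (Msg b))
    {K x β : ℝ} (hK : 0 ≤ K) (hx0 : 0 ≤ x) (hx1 : x ≤ 1) (hβ : β * 2 ^ b ≤ A.card)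
    (h1 : ∀ r, g r ≤ ENNReal.ofReal K) (h2 : ∀ r, r z ∈ A → g r ≤ ENNReal.ofReal (x * K)) :
    ∑' r, PMF.uniformOfFintype (Fin n → Msg b) r * g r ≤
      ENNReal.ofReal ((1 - β * (1 - x)) * K) := by
  classical
  set h : Msg b → ℝ := fun m => K - if m ∈ A then (1 - x) * K else 0 with hh
  have hnn : ∀ m, 0 ≤ h m := by
    intro m
    simp only [hh]
    split_ifs
    · nlinarith
    · simpa using hK
  have hg : ∀ r, g r ≤ ENNReal.ofReal (h (r z)) := by
    intro r
    simp only [hh]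
    split_ifs with hr
    · refine (h2 r hr).trans (ENNReal.ofReal_le_ofReal ?_)
      linarith
    · simpa using h1 r
  have hN : (0 : ℝ) < Fintype.card (Fin n → Msg b) := by exact_mod_cast Fintype.card_pos
  calc ∑' r, PMF.uniformOfFintype (Fin n → Msg b) r * g r
      ≤ ∑ r : Fin n → Msg b,
          ENNReal.ofReal ((Fintype.card (Fin n → Msg b) : ℝ)⁻¹ * h (r z)) := by
        rw [tsum_fintype]
        refine Finset.sum_le_sum fun r _ => ?_
        rw [PMF.uniformOfFintype_apply, ENNReal.ofReal_mul (inv_nonneg.2 hN.le),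
          ENNReal.ofReal_inv_of_pos hN, ENNReal.ofReal_natCast]
        exact mul_le_mul_right (hg r) _
    _ = ENNReal.ofReal ((Fintype.card (Msg b) : ℝ)⁻¹ * ∑ m, h m) := by
        rw [← ENNReal.ofReal_sum_of_nonneg
          (fun r _ => mul_nonneg (inv_nonneg.2 hN.le) (hnn _)), ← Finset.mul_sum, sum_comp_eval]
    _ ≤ _ := by
        apply ENNReal.ofReal_le_ofReal
        have hc : (Fintype.card (Msg b) : ℝ) = 2 ^ b := by simp [Msg]
        have hpos : (0 : ℝ) < 2 ^ b := by positivity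
        rw [hc, inv_mul_le_iff₀ hpos]
        simp only [hh, Finset.sum_sub_distrib, Finset.sum_const, Finset.card_univ, nsmul_eq_mul,
          Finset.sum_ite_mem, Finset.univ_inter, hc]
        nlinarith [mul_le_mul_of_nonneg_right hβ (mul_nonneg (sub_nonneg.2 hx1) hK)]

/-! ## Broadcasting -/

section Aggregation

variable {n b : ℕ}

lemma AggFun.total_eq_unit (F : AggFun b) {A : Set (Fin n)} {x : Fin n → Msg b}
    (h : ∀ w, x w = F.unit) : F.total A x = F.unit := by
  classical
  unfold AggFun.total
  have : Std.Commutative F.op := ⟨F.comm⟩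
  have : Std.Associative F.op := ⟨F.assoc⟩
  generalize Finset.univ.filter (· ∈ A) = B
  induction B using Finset.induction_on with
  | empty => simp
  | insert a B ha ih => rw [Finset.fold_insert ha, ih, h, F.unit_op]

lemma AggFun.total_eq_of_speaker (F : AggFun b) {A : Set (Fin n)} {x : Fin n → Msg b} {z : Fin n}
    (hz : z ∈ A) (h : ∀ w, w ≠ z → x w = F.unit) : F.total A x = x z := by
  classical
  unfold AggFun.total
  have : Std.Commutative F.op := ⟨F.comm⟩
  have : Std.Associative F.op := ⟨F.assoc⟩
  have hB : z ∈ Finset.univ.filter (· ∈ A) := by simpa using hz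
  rw [← Finset.insert_erase hB, Finset.fold_insert (Finset.notMem_erase _ _), F.comm]
  have : ∀ B : Finset (Fin n), z ∉ B → Finset.fold F.op F.unit x B = F.unit := by
    intro B
    induction B using Finset.induction_on with
    | empty => simp
    | insert a B ha ih =>
      intro hzB
      rw [Finset.mem_insert, not_or] at hzB
      rw [Finset.fold_insert ha, ih hzB.2, h a (Ne.symm hzB.1), F.unit_op]
  rw [this _ (Finset.notMem_erase _ _), F.unit_op]

/-- Aggregation by the maximum. -/
def maxAgg (b : ℕ) : AggFun b where
  op := max
  unit := ⊥
  comm := max_comm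
  assoc := max_assoc
  unit_op := bot_sup_eq

/-- The whole network. -/
def fullSpec (n : ℕ) (σ : Type) : SubgraphSpec n σ where
  alive _ := true
  mark _ _ := true

lemma fullSpec_graph {σ : Type} (G : SimpleGraph (Fin n)) (s : Fin n → σ) :
    (fullSpec n σ).graph G s = G := by
  ext u v
  simp [SubgraphSpec.graph, fullSpec]

end Aggregation

/-! ## Pieces from predecessor trees -/

section Lift

variable {V : Type*} {H H' : SimpleGraph V} {f : V → Option V} {ℓ : Sym2 V → ℝ≥0}

/-- Pointer walks have to be moved between the remaining graph, the tree and `G`, all of which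
contain the pointer edges. -/
lemma Follows.lift (hH : ∀ u v, H.Adj u v → f u = some v → H'.Adj u v) {u s : V} {p : H.Walk u s}
    (hp : Follows f p) :
    ∃ q : H'.Walk u s, Follows f q ∧ q.support = p.support ∧ wlen ℓ q = wlen ℓ p := by
  induction p with
  | nil => exact ⟨.nil, by simp [Follows], rfl, by simp [wlen_nil]⟩
  | cons h p ih =>
    rw [follows_cons] at hp
    obtain ⟨q, h1, h2, h3⟩ := ih hp.2
    refine ⟨.cons (hH _ _ h hp.1) q, follows_cons.2 ⟨hp.1, h1⟩, ?_, ?_⟩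
    · rw [SimpleGraph.Walk.support_cons, SimpleGraph.Walk.support_cons, h2]
    · rw [wlen_cons, wlen_cons, h3]

end Lift

/-! ### From correct shortest path answers to a piece. -/

section Answers

variable {n : ℕ} {G H : SimpleGraph (Fin n)} {ℓ : Sym2 (Fin n) → ℝ≥0} {α : ℝ≥0}
  {ans : Fin n → SSPResult n} {s t v : Fin n}

lemma IsApproxSSP.pred_source (h : IsApproxSSP α H ℓ {s} ans) : (ans s).pred = none :=
  h.source s (Finset.mem_singleton_self s)

lemma IsApproxSSP.exists_follows (h : IsApproxSSP α H ℓ {s} ans) (hv : H.Reachable v s) :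
    ∃ p : H.Walk v s, Follows (fun u => (ans u).pred) p ∧ (ans v).dist = wlen ℓ p := by
  obtain ⟨s', hs', p, hp⟩ := h.tree v (by rw [setDist_singleton]; exact gdist_ne_top hv)
  obtain rfl := Finset.mem_singleton.1 hs'
  exact ⟨p, hp⟩

lemma IsApproxSSP.pred_eq_none (h : IsApproxSSP α H ℓ {s} ans) (hv : ¬ H.Reachable v s) :
    (ans v).pred = none := by
  refine (h.unreachable v ?_).2
  rw [setDist_singleton]
  by_contra h'
  exact hv (reachable_of_gdist_ne_top h')

/-- The nodes of the tree path from `t` to `s`, recognized by comparing the pointers to `s` with the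
pointers to `t` in the tree. -/
lemma mem_treePath_iff {T : SimpleGraph (Fin n)} {ans' : Fin n → SSPResult n}
    (hT : ∀ u v, T.Adj u v ↔ H.Adj u v ∧ ((ans u).pred = some v ∨ (ans v).pred = some u))
    (h : IsApproxSSP α H ℓ {s} ans) (h' : IsApproxSSP α T ℓ {t} ans') {c : H.Walk t s}
    (hc : Follows (fun u => (ans u).pred) c) (v : Fin n) :
    v ∈ c.support ↔ v = t ∨ (ans v).pred ≠ (ans' v).pred := by
  have hup : ∀ u v, H.Adj u v → (ans u).pred = some v → T.Adj u v :=
    fun u v huv hf => (hT u v).2 ⟨huv, Or.inl hf⟩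
  have hTH : T ≤ H := fun u v huv => ((hT u v).1 huv).1
  obtain ⟨c', hc', hsupp, -⟩ := hc.lift (ℓ := ℓ) hup
  by_cases hvt : v = t
  · simp [hvt]
  rw [← hsupp]
  by_cases hvs : H.Reachable v s
  · obtain ⟨p, hp, -⟩ := h.exists_follows hvs
    obtain ⟨p', hp', -⟩ := hp.lift (ℓ := ℓ) hup
    obtain ⟨q, hq, -⟩ := h'.exists_follows (v := v) ⟨p'.append c'.reverse⟩
    rw [mem_support_iff_pred_ne (fun u v huv => ((hT u v).1 huv).2) h.pred_source h'.pred_source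
      hc' hp' hq hvt]
    simp [hvt]
  · have hvT : ¬ T.Reachable v t := fun hr => hvs ((hr.mono hTH).trans ⟨c⟩)
    rw [h.pred_eq_none hvs, h'.pred_eq_none hvT]
    simp only [hvt, ne_eq, not_true_eq_false, or_self, iff_false]
    intro hv
    exact hvT (c'.takeUntil v hv).reverse.reachable

/-- Reported distances are lengths of actual walks, so nodes of the ball are truly within `r` of the
path; the factor 2 means that nodes left out are farther than `r / 2`. The path is the reversed
pointer walk, so that predecessors on it are the pointers to the source. -/
lemma exists_piece {U : Finset (Fin n)} {T : SimpleGraph (Fin n)}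
    {ans₁ ans₂ ans₃ : Fin n → SSPResult n} {D r : ℝ≥0} {onPath : Fin n → Bool}
    (hs : s ∈ U) (h₁ : IsApproxSSP 2 (restrict G U) ℓ {s} ans₁)
    (hdist : (ans₁ t).dist ≤ (4 * D : ℝ≥0))
    (hT : ∀ u v, T.Adj u v ↔
      (restrict G U).Adj u v ∧ ((ans₁ u).pred = some v ∨ (ans₁ v).pred = some u))
    (h₂ : IsApproxSSP 2 T ℓ {t} ans₂)
    (hon : ∀ v, onPath v = true ↔ v = t ∨ (ans₁ v).pred ≠ (ans₂ v).pred)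
    (h₃ : IsApproxSSP 2 G ℓ (Finset.univ.filter fun v => onPath v = true) ans₃) :
    ∃ P : Piece G, IsApproxShortestPath 2 G ℓ U P.walk ∧ wlen ℓ P.walk ≤ 4 * D ∧
      (∀ w ∈ P.ball, setDist G ℓ w P.verts ≤ r) ∧
      (∀ v, v ∈ P.verts ↔ onPath v = true) ∧ (∀ v, v ∈ P.ball ↔ (ans₃ v).dist ≤ r) ∧
      (∀ v, (P.view v).pred = if onPath v then (ans₁ v).pred else none) ∧
      (∀ y ∉ P.ball, ∀ c : (restrict G U).Walk t s, Follows (fun u => (ans₁ u).pred) c →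
        ∀ x ∈ c.support, ((r / 2 : ℝ≥0) : ℝ≥0∞) < gdist G ℓ y x) := by
  classical
  -- An unreachable target would report `⊤`, so the length test also certifies reachability.
  have hts : (restrict G U).Reachable t s := by
    by_contra hr
    have := (h₁.unreachable t (by
      rw [setDist_singleton]; by_contra h'; exact hr (reachable_of_gdist_ne_top h'))).1
    rw [this] at hdist
    exact ENNReal.coe_ne_top (top_le_iff.1 hdist)
  obtain ⟨c, hc, hlen⟩ := h₁.exists_follows hts
  have hmem : ∀ v, v ∈ c.support ↔ onPath v = true := fun v => by
    rw [mem_treePath_iff hT h₁ h₂ hc v, hon]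
  obtain ⟨c', hc', hsupp, hw⟩ := hc.lift (ℓ := ℓ) (H' := G) (fun _ _ h _ => restrict_le U h)
  have hverts : ∀ v, v ∈ c'.reverse.support ↔ onPath v = true := fun v => by
    rw [SimpleGraph.Walk.support_reverse, List.mem_reverse, hsupp, hmem]
  have hset : c'.reverse.support.toFinset = Finset.univ.filter fun v => onPath v = true := by
    ext v
    rw [List.mem_toFinset, hverts]
    simp
  refine ⟨⟨⟨s, t, c'.reverse⟩, Finset.univ.filter fun v => (ans₃ v).dist ≤ r⟩,
    ⟨?_, ?_, ?_⟩, ?_, ?_, ?_, ?_, ?_, ?_⟩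
  · exact (hc'.isPath h₁.pred_source).reverse
  · intro x hx
    have hx' : x ∈ c.support := (hmem x).2 ((hverts x).1 hx)
    exact mem_of_restrict_walk c hs x hx'
  · have := h₁.approx t (by rw [setDist_singleton]; exact gdist_ne_top hts)
    rw [hlen, setDist_singleton, gdist_comm] at this
    rwa [wlen_reverse, hw]
  · rw [hlen] at hdist
    change wlen ℓ c'.reverse ≤ 4 * D
    rw [wlen_reverse, hw]
    exact_mod_cast hdist
  · intro w hw'
    have hw' : (ans₃ w).dist ≤ r := by simpa using hw'
    change setDist G ℓ w c'.reverse.support.toFinset ≤ r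
    rw [hset]
    by_cases htop : setDist G ℓ w (Finset.univ.filter fun v => onPath v = true) = ⊤
    · rw [(h₃.unreachable w htop).1] at hw'
      exact absurd (top_le_iff.1 hw') ENNReal.coe_ne_top
    · obtain ⟨x, hx, p, -, hp⟩ := h₃.tree w htop
      exact (setDist_le hx).trans ((gdist_le_wlen p).trans (hp ▸ hw'))
  · intro v
    change v ∈ c'.reverse.support.toFinset ↔ _
    rw [List.mem_toFinset, hverts]
  · intro v
    simp
  · intro v
    have := hc'.find_reverse h₁.pred_source v
    rw [hsupp] at this
    simp only [hmem] at this
    rw [← this]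
    simp only [Piece.view]
    congr!
  · intro y hy c₁ hc₁ x hx
    have hy : ¬ (ans₃ y).dist ≤ r := by simpa using hy
    rw [hc₁.support_eq h₁.pred_source hc, hmem] at hx
    by_contra hle
    rw [not_lt] at hle
    have hle' : setDist G ℓ y (Finset.univ.filter fun v => onPath v = true) ≤
        ((r / 2 : ℝ≥0) : ℝ≥0∞) := (setDist_le (by simpa using hx)).trans hle
    apply hy
    refine (h₃.approx y (ne_top_of_le_ne_top ENNReal.coe_ne_top hle')).trans ?_
    refine (mul_le_mul_right hle' _).trans ?_
    rw [← ENNReal.coe_mul, mul_div_cancel₀ r two_ne_zero]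

end Answers

section Pieces

variable {V : Type*} [DecidableEq V] {G : SimpleGraph V} {ℓ : Sym2 V → ℝ≥0}

lemma piecesRest_append_singleton (S : List (Piece G)) (P : Piece G) :
    ∀ U : Finset V, piecesRest U (S ++ [P]) = piecesRest U S \ (P.verts ∪ P.ball) := by
  induction S with
  | nil => intro U; rfl
  | cons Q S ih => intro U; exact ih _

lemma carved_append_singleton {D ε : ℝ≥0} (S : List (Piece G)) (P : Piece G) :
    ∀ U : Finset V, Carved ℓ D ε U (S ++ [P]) ↔
      Carved ℓ D ε U S ∧ Carved ℓ D ε (piecesRest U S) [P] := by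
  induction S with
  | nil => intro U; simp [Carved, piecesRest]
  | cons Q S ih =>
    intro U
    simp only [List.cons_append, Carved, piecesRest, ih, and_assoc]

end Pieces

/-! ## The algorithm -/

/-- The state of a node. -/
structure NodeState (n b : ℕ) where
  id : Fin n
  alive : Bool
  coins : Msg b
  src : Msg b
  dst : Msg b
  toSrc : SSPResult n
  toDst : SSPResult n
  ok : Bool
  outs : List (NodeOutput n)

namespace NodeState

variable {n b : ℕ}

/-- Node `0` contributes its coins. -/
def speak (st : NodeState n b) : Msg b := if st.id.val = 0 then st.coins else ⊥

/-- Whether the node is the chosen source. -/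
def isSrc (st : NodeState n b) : Bool := st.alive && decide (st.id.val = st.src.val)

/-- Whether the node is the chosen target. -/
def isDst (st : NodeState n b) : Bool := st.alive && decide (st.id.val = st.dst.val)

/-- The target reports that its tree path is not too long. -/
def report (D : ℝ≥0) (st : NodeState n b) : Msg b :=
  if st.isDst = true ∧ st.toSrc.dist ≤ (4 * D : ℝ≥0) then ⊤ else ⊥

/-- Whether the node is on the tree path. -/
def onPath (st : NodeState n b) : Bool := decide (st.isDst = true ∨ st.toSrc.pred ≠ st.toDst.pred)

/-- Record a piece and leave the remaining graph if the piece contains the node. -/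
def finish (r : ℝ≥0) (st : NodeState n b) (a : SSPResult n) : NodeState n b :=
  if st.ok = true then
    { st with
      alive := st.alive && !(st.onPath || decide (a.dist ≤ r))
      outs := st.outs ++
        [⟨st.onPath, if st.onPath = true then st.toSrc.pred else none, decide (a.dist ≤ r)⟩] }
  else st

end NodeState

section Program

variable {n b : ℕ}

/-- The nodes that have not been removed. -/
def aliveSpec (n b : ℕ) : SubgraphSpec n (NodeState n b) where
  alive st := st.alive
  mark _ _ := true

/-- The tree of the pointers to the source. -/
def treeSpec (n b : ℕ) : SubgraphSpec n (NodeState n b) where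
  alive st := st.alive
  mark st v := decide (st.toSrc.pred = some v)

/-- Each round removes the neighbourhood of a tree path between two random nodes. -/
def separatorProgram (n b : ℕ) (D ε : ℝ≥0) : ℕ → List (Instr n b (NodeState n b))
  | 0 => []
  | T + 1 =>
    .compute (fun st r => { st with coins := r }) ::
    .aggregate (fullSpec n _) NodeState.speak (maxAgg b) (fun st m => { st with src := m }) ::
    .ssp (aliveSpec n b) NodeState.isSrc (fun st a => { st with toSrc := a }) ::
    .compute (fun st r => { st with coins := r }) ::
    .aggregate (fullSpec n _) NodeState.speak (maxAgg b) (fun st m => { st with dst := m }) ::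
    .ssp (treeSpec n b) NodeState.isDst (fun st a => { st with toDst := a }) ::
    .aggregate (fullSpec n _) (NodeState.report D) (maxAgg b)
      (fun st m => { st with ok := decide (m ≠ ⊥) }) ::
    .ssp (fullSpec n _) NodeState.onPath (NodeState.finish (ε * D)) ::
    separatorProgram n b D ε T

lemma separatorProgram_countP_isAggregate (D ε : ℝ≥0) (T : ℕ) :
    (separatorProgram n b D ε T).countP Instr.isAggregate = 3 * T := by
  induction T with
  | zero => rfl
  | succ T ih => simp [separatorProgram, List.countP_cons, Instr.isAggregate, ih]; ring

lemma separatorProgram_countP_isSSP (D ε : ℝ≥0) (T : ℕ) :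
    (separatorProgram n b D ε T).countP Instr.isSSP = 3 * T := by
  induction T with
  | zero => rfl
  | succ T ih => simp [separatorProgram, List.countP_cons, Instr.isSSP, ih]; ring

/-- The distributed separator algorithm with `T` rounds. -/
def separatorAlgorithm (n b : ℕ) (D ε : ℝ≥0) (T : ℕ) : Algorithm n b where
  State := NodeState n b
  start v _ := ⟨v, true, ⊥, ⊥, ⊥, ⟨⊤, none⟩, ⟨⊤, none⟩, false, []⟩
  program := separatorProgram n b D ε T
  output st := st.outs

lemma separatorAlgorithm_countP_isAggregate (D ε : ℝ≥0) (T : ℕ) :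
    (separatorAlgorithm n b D ε T).program.countP Instr.isAggregate = 3 * T :=
  separatorProgram_countP_isAggregate D ε T

lemma separatorAlgorithm_countP_isSSP (D ε : ℝ≥0) (T : ℕ) :
    (separatorAlgorithm n b D ε T).program.countP Instr.isSSP = 3 * T :=
  separatorProgram_countP_isSSP D ε T

end Program

/-! ## One round -/

section Round

variable {n b : ℕ} {G : SimpleGraph (Fin n)} {ℓ : Sym2 (Fin n) → ℝ≥0} {D ε : ℝ≥0}
  {s : Fin n → NodeState n b} {S : List (Piece G)}

/-- The nodes agree on the pieces in `S`. -/
structure Consistent (s : Fin n → NodeState n b) (S : List (Piece G)) : Prop where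
  id : ∀ v, (s v).id = v
  alive : ∀ v, (s v).alive = true ↔ v ∈ piecesRest Finset.univ S
  outs : ∀ v, (s v).outs = S.map fun P => P.view v

/-- The nodes hold the answer to a shortest path computation from the node `src`. -/
structure HasSource (ℓ : Sym2 (Fin n) → ℝ≥0) (s : Fin n → NodeState n b) (S : List (Piece G))
    (m : Msg b) : Prop extends Consistent s S where
  answer : IsApproxSSP 2 (restrict G (piecesRest Finset.univ S)) ℓ
    (Finset.univ.filter fun v => v ∈ piecesRest Finset.univ S ∧ v.val = m.val)
    fun v => (s v).toSrc

/-- The private bits of node `0` become shared randomness: all other nodes contribute the neutral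
element. -/
lemma total_speak (hG : ∀ u v, G.Reachable u v) (hid : ∀ v, (s v).id = v) {z : Fin n}
    (hz : z.val = 0) (v : Fin n) :
    (maxAgg b).total {w | ((fullSpec n (NodeState n b)).graph G s).Reachable v w}
      (fun w => (s w).speak) = (s z).coins := by
  rw [AggFun.total_eq_of_speaker (z := z)]
  · simp [NodeState.speak, hid, hz]
  · rw [fullSpec_graph]
    exact hG v z
  · intro w hw
    have : w.val ≠ 0 := fun h => hw (Fin.ext (h.trans hz.symm))
    simp [NodeState.speak, hid, this, maxAgg]

lemma total_report (hb : b ≠ 0) (hG : ∀ u v, G.Reachable u v) (hid : ∀ v, (s v).id = v)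
    {m : Msg b} (hm : ∀ v, (s v).dst = m) (v : Fin n) :
    (maxAgg b).total {w | ((fullSpec n (NodeState n b)).graph G s).Reachable v w}
      (fun w => (s w).report D) ≠ ⊥ ↔
      ∃ t, (s t).isDst = true ∧ (s t).toSrc.dist ≤ (4 * D : ℝ≥0) := by
  constructor
  · intro h
    by_contra hne
    push Not at hne
    refine h (AggFun.total_eq_unit _ fun w => ?_)
    rw [NodeState.report, if_neg fun hw => (hne w hw.1).not_ge hw.2]
    rfl
  · rintro ⟨t, ht, hd⟩
    rw [AggFun.total_eq_of_speaker (z := t)]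
    · have : Nontrivial (Msg b) := by
        have : 2 ≤ 2 ^ b := by
          calc 2 = 2 ^ 1 := rfl
            _ ≤ 2 ^ b := Nat.pow_le_pow_right (by norm_num) (Nat.one_le_iff_ne_zero.2 hb)
        exact Fin.nontrivial_iff_two_le.2 this
      rw [NodeState.report, if_pos ⟨ht, hd⟩]
      exact top_ne_bot
    · rw [fullSpec_graph]
      exact hG v t
    · intro w hw
      rw [NodeState.report, if_neg]
      · rfl
      · rintro ⟨h, -⟩
        simp only [NodeState.isDst, Bool.and_eq_true, decide_eq_true_eq, hid, hm] at h ht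
        exact hw (Fin.ext (h.2.trans ht.2.symm))

lemma aliveSpec_graph (h : Consistent s S) :
    (aliveSpec n b).graph G s = restrict G (piecesRest Finset.univ S) := by
  ext u v
  simp [SubgraphSpec.graph, aliveSpec, restrict, h.alive]

/-- The first half of a round after the coins have been drawn. -/
lemma exec_first_half (hG : ∀ u v, G.Reachable u v) {z : Fin n} (hz : z.val = 0)
    {O : Oracle n (NodeState n b)} (hO : O.Correct G ℓ) (h : Consistent s S)
    (is : List (Instr n b (NodeState n b))) (hist : List (Fin n → NodeState n b)) :
    ∃ hist' s', exec G O
        (.aggregate (fullSpec n _) NodeState.speak (maxAgg b) (fun st m => { st with src := m }) ::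
          .ssp (aliveSpec n b) NodeState.isSrc (fun st a => { st with toSrc := a }) :: is) hist s =
        exec G O is hist' s' ∧ HasSource ℓ s' S (s z).coins := by
  refine ⟨_, _, rfl, ?_⟩
  simp only [total_speak hG h.id hz]
  set s₁ : Fin n → NodeState n b := fun v => { s v with src := (s z).coins } with hs₁
  have h₁ : Consistent s₁ S := ⟨h.id, h.alive, h.outs⟩
  refine ⟨⟨h.id, h.alive, h.outs⟩, ?_⟩
  rw [aliveSpec_graph h₁]
  have hsrc : (Finset.univ.filter fun w => (s₁ w).isSrc = true) =
      Finset.univ.filter fun v => v ∈ piecesRest Finset.univ S ∧ v.val = (s z).coins.val := by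
    ext v
    simp [NodeState.isSrc, hs₁, h.id, h.alive]
  rw [hsrc]
  exact hO _ _ _ (restrict_le _)

/-- The second half of a round after the coins have been drawn. -/
lemma exec_second_half (hb : b ≠ 0) (hG : ∀ u v, G.Reachable u v) {z : Fin n} (hz : z.val = 0)
    {O : Oracle n (NodeState n b)} (hO : O.Correct G ℓ) {m : Msg b} (h : HasSource ℓ s S m)
    (hS : Carved ℓ D ε Finset.univ S)
    (is : List (Instr n b (NodeState n b))) (hist : List (Fin n → NodeState n b)) :
    ∃ (hist' : _) (s' : _) (S' : List (Piece G)), exec G O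
        (.aggregate (fullSpec n _) NodeState.speak (maxAgg b) (fun st m => { st with dst := m }) ::
          .ssp (treeSpec n b) NodeState.isDst (fun st a => { st with toDst := a }) ::
          .aggregate (fullSpec n _) (NodeState.report D) (maxAgg b)
            (fun st m => { st with ok := decide (m ≠ ⊥) }) ::
          .ssp (fullSpec n _) NodeState.onPath (NodeState.finish (ε * D)) :: is) hist s =
        exec G O is hist' s' ∧ Consistent s' S' ∧ Carved ℓ D ε Finset.univ S' ∧
        S'.length ≤ S.length + 1 ∧
        piecesRest Finset.univ S' ⊆ piecesRest Finset.univ S ∧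
        ∀ t ∈ piecesRest Finset.univ S, t.val = (s z).coins.val →
          (s t).toSrc.dist ≤ (4 * D : ℝ≥0) →
          ∀ src, src.val = m.val → ∀ y ∈ piecesRest Finset.univ S',
            ∀ c : (restrict G (piecesRest Finset.univ S)).Walk t src,
              Follows (fun u => (s u).toSrc.pred) c → ∀ x ∈ c.support,
                ((ε * D / 2 : ℝ≥0) : ℝ≥0∞) < gdist G ℓ y x := by
  classical
  set U := piecesRest Finset.univ S with hU
  set s₁ : Fin n → NodeState n b := fun v => { s v with dst := (s z).coins } with hs₁
  set T := (treeSpec n b).graph G s₁ with hTdef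
  set ans₂ := O (s₁ :: s :: hist) T (Finset.univ.filter fun w => (s₁ w).isDst = true) with hans₂
  set s₂ : Fin n → NodeState n b := fun v => { s₁ v with toDst := ans₂ v } with hs₂
  have hdst : ∀ v, (s₂ v).isDst = true ↔ v ∈ U ∧ v.val = (s z).coins.val := fun v => by
    simp [NodeState.isDst, hs₂, hs₁, h.id, h.alive, hU]
  have hok := total_report (D := D) (G := G) (s := s₂) hb hG h.id (fun v => rfl)
  set s₃ : Fin n → NodeState n b := fun v =>
    { s₂ v with ok := decide (∃ t, (s₂ t).isDst = true ∧ (s₂ t).toSrc.dist ≤ (4 * D : ℝ≥0)) }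
    with hs₃
  set ans₃ := O (s₃ :: s₂ :: s₁ :: s :: hist) G
    (Finset.univ.filter fun w => (s₃ w).onPath = true) with hans₃
  have hexec : exec G O
        (.aggregate (fullSpec n _) NodeState.speak (maxAgg b) (fun st m => { st with dst := m }) ::
          .ssp (treeSpec n b) NodeState.isDst (fun st a => { st with toDst := a }) ::
          .aggregate (fullSpec n _) (NodeState.report D) (maxAgg b)
            (fun st m => { st with ok := decide (m ≠ ⊥) }) ::
          .ssp (fullSpec n _) NodeState.onPath (NodeState.finish (ε * D)) :: is) hist s =
      exec G O is (s₃ :: s₂ :: s₁ :: s :: hist) fun v => (s₃ v).finish (ε * D) (ans₃ v) := by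
    -- The program unfolds by definition; only the two aggregates and the designated full graph need
    -- rewriting.
    refine (congrArg (exec G O _ (s :: hist)) (a₂ := s₁) (funext fun v =>
      congrArg (fun m => { s v with dst := m }) (total_speak hG h.id hz v))).trans ?_
    refine (congrArg (exec G O _ (s₂ :: s₁ :: s :: hist)) (a₂ := s₃) (funext fun v =>
      congrArg (fun a => { s₂ v with ok := a }) (decide_eq_decide.2 (hok v)))).trans ?_
    rw [exec, fullSpec_graph]
  by_cases hex : ∃ t, (s₂ t).isDst = true ∧ (s₂ t).toSrc.dist ≤ (4 * D : ℝ≥0)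
  · have hok₃ : ∀ v, (s₃ v).ok = true := fun v => decide_eq_true hex
    obtain ⟨t, ht, hlen⟩ := hex
    have hlen : (s t).toSrc.dist ≤ (4 * D : ℝ≥0) := hlen
    obtain ⟨src, hsrc⟩ : ∃ src, src ∈ U ∧ src.val = m.val := by
      -- If the drawn message names no remaining node, the source set is empty and all distances are
      -- `⊤`.
      by_contra hne
      push Not at hne
      have hemp : (Finset.univ.filter fun v : Fin n => v ∈ U ∧ v.val = m.val) = ∅ := by
        ext v
        simpa using hne v
      have := (h.answer.unreachable t (by rw [hemp, setDist_empty])).1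
      rw [this] at hlen
      exact ENNReal.coe_ne_top (top_le_iff.1 hlen)
    have hsrcs : (Finset.univ.filter fun v : Fin n => v ∈ U ∧ v.val = m.val) = {src} := by
      ext v
      simp only [Finset.mem_filter, Finset.mem_univ, true_and, Finset.mem_singleton]
      exact ⟨fun hv => Fin.ext (hv.2.trans hsrc.2.symm), fun hv => hv ▸ hsrc⟩
    have hdsts : (Finset.univ.filter fun w => (s₁ w).isDst = true) = {t} := by
      ext v
      simp only [Finset.mem_filter, Finset.mem_univ, true_and, Finset.mem_singleton]
      have ht' := (hdst t).1 ht
      exact ⟨fun hv => Fin.ext (((hdst v).1 hv).2.trans ht'.2.symm), fun hv => hv ▸ ht⟩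
    have ha₁ := h.answer
    rw [hsrcs] at ha₁
    have hT : ∀ u v, T.Adj u v ↔ (restrict G U).Adj u v ∧
        ((s u).toSrc.pred = some v ∨ (s v).toSrc.pred = some u) := fun u v => by
      simp only [hTdef, SubgraphSpec.graph, treeSpec, restrict, hs₁, h.alive, hU, and_assoc,
        decide_eq_true_eq]
    have ha₂ : IsApproxSSP 2 T ℓ {t} ans₂ :=
      hdsts ▸ hO _ _ _ fun u v huv => ((hT u v).1 huv).1.1
    have hon : ∀ v, (s₃ v).onPath = true ↔ v = t ∨ (s v).toSrc.pred ≠ (ans₂ v).pred := by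
      intro v
      have h1 : (s₃ v).isDst = true ↔ v = t := by
        have : v ∈ Finset.univ.filter (fun w => (s₁ w).isDst = true) ↔ v ∈ ({t} : Finset _) := by
          rw [hdsts]
        simp only [Finset.mem_filter, Finset.mem_univ, true_and, Finset.mem_singleton] at this
        exact this
      simp only [NodeState.onPath, decide_eq_true_eq, h1]
      rfl
    have ha₃ : IsApproxSSP 2 G ℓ (Finset.univ.filter fun w => (s₃ w).onPath = true) ans₃ :=
      hO _ _ _ le_rfl
    obtain ⟨P, hP1, hP2, hP3, hverts, hball, hview, hfar⟩ :=
      exists_piece (r := ε * D) hsrc.1 ha₁ hlen hT ha₂ hon ha₃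
    have hrest : ∀ v, v ∈ piecesRest Finset.univ (S ++ [P]) ↔
        v ∈ U ∧ ¬ ((s₃ v).onPath = true ∨ (ans₃ v).dist ≤ (ε * D : ℝ≥0)) := fun v => by
      rw [piecesRest_append_singleton, Finset.mem_sdiff, Finset.mem_union, hverts, hball]
    refine ⟨_, _, S ++ [P], hexec, ?_, ?_, by simp, ?_, ?_⟩
    · simp only [NodeState.finish, hok₃, if_true]
      refine ⟨h.id, ?_, ?_⟩
      · intro v
        rw [hrest, hU, ← h.alive v]
        simp [hs₃, hs₂, hs₁, -ENNReal.coe_mul]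
      · intro v
        have hv : P.view v = ⟨(s₃ v).onPath,
            if (s₃ v).onPath = true then (s v).toSrc.pred else none,
            decide ((ans₃ v).dist ≤ (ε * D : ℝ≥0))⟩ := by
          have h1 : (P.view v).onPath = (s₃ v).onPath := by
            rw [Bool.eq_iff_iff, ← hverts]
            simp [Piece.view, GWalk.verts]
          have h2 : (P.view v).inBall = decide ((ans₃ v).dist ≤ (ε * D : ℝ≥0)) := by
            rw [Bool.eq_iff_iff, decide_eq_true_eq, ← hball]
            simp [Piece.view]
          rw [← h1, ← h2, h1, ← hview]
          cases hPv : P.view v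
          rw [hPv] at h1
          simp only at h1
          rw [← h1]
        rw [List.map_append, ← h.outs, List.map_singleton, hv]
    · rw [carved_append_singleton]
      exact ⟨hS, hP1, hP2, hP3, trivial⟩
    · exact fun v hv => ((hrest v).1 hv).1
    · intro t' ht' hm' _ src' hsrc' y hy c hc
      obtain rfl : t' = t := Fin.ext (hm'.trans ((hdst t).1 ht).2.symm)
      obtain rfl : src' = src := Fin.ext (hsrc'.trans hsrc.2.symm)
      refine hfar y (fun hyb => ((hrest y).1 hy).2 (Or.inr ((hball y).1 hyb))) c hc
  · have hfin : ∀ v, (s₃ v).finish (ε * D) (ans₃ v) = s₃ v := fun v => by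
      rw [NodeState.finish, if_neg (by rw [Bool.not_eq_true]; exact decide_eq_false hex)]
    refine ⟨_, _, S, hexec, ?_, hS, by simp, subset_rfl, ?_⟩
    · simp only [hfin]
      exact ⟨h.id, h.alive, h.outs⟩
    intro t ht hm hlen
    exact absurd ⟨t, (hdst t).2 ⟨ht, hm⟩, hlen⟩ hex

end Round

/-! ## The failure probability -/

section Failure

variable {n b : ℕ} {G : SimpleGraph (Fin n)} {ℓ : Sym2 (Fin n) → ℝ≥0} {D ε : ℝ≥0}
  {Ls : List (List (GWalk G))}

/-- Some ball of `G[U]` is too large. -/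
def Heavy (G : SimpleGraph (Fin n)) (ℓ : Sym2 (Fin n) → ℝ≥0) (D : ℝ≥0) (U : Finset (Fin n)) :
    Prop :=
  ∃ v ∈ U, 7 / 8 * (n : ℝ) < ((gball (restrict G U) ℓ v D).ncard : ℝ)

lemma Heavy.mono {U U' : Finset (Fin n)} (h : U' ⊆ U) (hU : Heavy G ℓ D U') : Heavy G ℓ D U := by
  obtain ⟨v, hv, hlt⟩ := hU
  refine ⟨v, h hv, hlt.trans_le ?_⟩
  exact_mod_cast Set.ncard_le_ncard (gball_anti (restrict_mono h) v D) (Set.toFinite _)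

open Classical in
/-- The bound on the probability of failure, up to a factor that decreases with each round. -/
def failBound (ℓ : Sym2 (Fin n) → ℝ≥0) (D ε : ℝ≥0) (Ls : List (List (GWalk G)))
    (U : Finset (Fin n)) : ℝ :=
  if Heavy G ℓ D U then 2 ^ potential ℓ (4 * D) (ε * D / 2) Finset.univ Ls U else 0

lemma failBound_nonneg (U : Finset (Fin n)) : 0 ≤ failBound ℓ D ε Ls U := by
  unfold failBound
  split_ifs <;> positivity

lemma failBound_mono {U U' : Finset (Fin n)} (h : U' ⊆ U) :
    failBound ℓ D ε Ls U' ≤ failBound ℓ D ε Ls U := by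
  by_cases hU : Heavy G ℓ D U'
  · rw [failBound, failBound, if_pos hU, if_pos (hU.mono h)]
    exact pow_le_pow_right₀ one_le_two (potential_mono Ls _ h)
  · rw [failBound, if_neg hU]
    exact failBound_nonneg U

lemma failBound_half {U U' : Finset (Fin n)} (h : U' ⊆ U)
    (hdec : potential ℓ (4 * D) (ε * D / 2) Finset.univ Ls U' + 1 ≤
      potential ℓ (4 * D) (ε * D / 2) Finset.univ Ls U) :
    failBound ℓ D ε Ls U' ≤ 1 / 2 * failBound ℓ D ε Ls U := by
  by_cases hU : Heavy G ℓ D U'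
  · rw [failBound, failBound, if_pos hU, if_pos (hU.mono h)]
    have : (2 : ℝ) ^ (potential ℓ (4 * D) (ε * D / 2) Finset.univ Ls U' + 1) ≤
      2 ^ potential ℓ (4 * D) (ε * D / 2) Finset.univ Ls U := pow_le_pow_right₀ one_le_two hdec
    rw [pow_succ] at this
    linarith
  · rw [failBound, if_neg hU]
    exact mul_nonneg (by norm_num) (failBound_nonneg U)

/-- The identifiers of a set of nodes as messages. -/
def idMsgs (h : n ≤ 2 ^ b) (A : Finset (Fin n)) : Finset (Msg b) := A.map (Fin.castLEEmb h)

lemma mem_idMsgs {h : n ≤ 2 ^ b} {A : Finset (Fin n)} {m : Msg b} :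
    m ∈ idMsgs h A ↔ ∃ v ∈ A, v.val = m.val := by
  simp [idMsgs, Fin.ext_iff]

/-- The pointers to the source are already fixed when the target is drawn. Hitting `A` halves the
bound, and any other draw does not increase it. -/
lemma exec_second_le (hb : b ≠ 0) (hn : n ≤ 2 ^ b)
    (hG : ∀ u v, G.Reachable u v) {z : Fin n} (hz : z.val = 0) {O : Oracle n (NodeState n b)}
    (hO : O.Correct G ℓ) {s : Fin n → NodeState n b} {S : List (Piece G)} {m : Msg b}
    (h : HasSource ℓ s S m) (hS : Carved ℓ D ε Finset.univ S)
    (is : List (Instr n b (NodeState n b))) (hist : List (Fin n → NodeState n b))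
    (Bad : Set (Fin n → NodeState n b)) {x : ℝ} (hx : 0 ≤ x)
    (hrec : ∀ hist' s' (S' : List (Piece G)), Consistent s' S' → Carved ℓ D ε Finset.univ S' →
      S'.length ≤ S.length + 1 → (exec G O is hist' s').toOuterMeasure Bad ≤
        ENNReal.ofReal (failBound ℓ D ε Ls (piecesRest Finset.univ S') * x))
    {β : ℝ} {A : Finset (Fin n)} (hβ : β * 2 ^ b ≤ A.card)
    (hA : ∀ t ∈ A, t ∈ piecesRest Finset.univ S ∧ (s t).toSrc.dist ≤ (4 * D : ℝ≥0) ∧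
      ∃ src, src.val = m.val ∧ ∀ U' ⊆ piecesRest Finset.univ S,
        (∀ y ∈ U', ∀ c : (restrict G (piecesRest Finset.univ S)).Walk t src,
          Follows (fun u => (s u).toSrc.pred) c → ∀ w ∈ c.support,
            ((ε * D / 2 : ℝ≥0) : ℝ≥0∞) < gdist G ℓ y w) →
        potential ℓ (4 * D) (ε * D / 2) Finset.univ Ls U' + 1 ≤
          potential ℓ (4 * D) (ε * D / 2) Finset.univ Ls (piecesRest Finset.univ S)) :
    (exec G O
      (.compute (fun st r => { st with coins := r }) ::
        .aggregate (fullSpec n _) NodeState.speak (maxAgg b) (fun st m => { st with dst := m }) ::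
        .ssp (treeSpec n b) NodeState.isDst (fun st a => { st with toDst := a }) ::
        .aggregate (fullSpec n _) (NodeState.report D) (maxAgg b)
          (fun st m => { st with ok := decide (m ≠ ⊥) }) ::
        .ssp (fullSpec n _) NodeState.onPath (NodeState.finish (ε * D)) :: is) hist s).toOuterMeasure
      Bad ≤ ENNReal.ofReal ((1 - β * (1 - 1 / 2)) *
        (failBound ℓ D ε Ls (piecesRest Finset.univ S) * x)) := by
  rw [exec, PMF.toOuterMeasure_bind_apply]
  have hstep : ∀ r : Fin n → Msg b,
      HasSource ℓ (fun v => { s v with coins := r v }) S m := fun r =>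
    ⟨⟨h.id, h.alive, h.outs⟩, h.answer⟩
  refine tsum_uniform_le z _ (idMsgs hn A) (mul_nonneg (failBound_nonneg _) hx) (by norm_num)
    (by norm_num) (by rwa [idMsgs, Finset.card_map]) ?_ ?_
  · intro r
    obtain ⟨hist', s', S', hex, hc, hS', hlen, hsub, -⟩ :=
      exec_second_half hb hG hz hO (hstep r) hS is (s :: hist)
    rw [hex]
    refine (hrec hist' s' S' hc hS' hlen).trans (ENNReal.ofReal_le_ofReal ?_)
    exact mul_le_mul_of_nonneg_right (failBound_mono hsub) hx
  · intro r hr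
    obtain ⟨t, ht, htm⟩ := mem_idMsgs.1 hr
    obtain ⟨hist', s', S', hex, hc, hS', hlen, hsub, hfar⟩ :=
      exec_second_half hb hG hz hO (hstep r) hS is (s :: hist)
    obtain ⟨htU, hd, src, hsrc, hpot⟩ := hA t ht
    rw [hex]
    refine (hrec hist' s' S' hc hS' hlen).trans (ENNReal.ofReal_le_ofReal ?_)
    rw [← mul_assoc]
    exact mul_le_mul_of_nonneg_right
      (failBound_half hsub (hpot _ hsub (hfar t htU htm hd src hsrc))) hx

/-- From each node of a large ball, many targets decrease the potential. -/
lemma exists_targets {U : Finset (Fin n)}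
    (hsep : ∀ v ∈ layersRest Finset.univ Ls, 2 * {w | w ∈ layersRest Finset.univ Ls ∧
        (restrict G (layersRest Finset.univ Ls)).Reachable v w}.ncard ≤ n)
    {v src : Fin n} (hv : v ∈ U)
    (hheavy : 7 / 8 * (n : ℝ) < ((gball (restrict G U) ℓ v D).ncard : ℝ))
    (hsrc : src ∈ gball (restrict G U) ℓ v D) {ans : Fin n → SSPResult n}
    (hans : IsApproxSSP 2 (restrict G U) ℓ {src} ans) :
    ∃ A : Finset (Fin n), 3 / 8 * (n : ℝ) ≤ A.card ∧ ∀ t ∈ A, t ∈ U ∧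
      (ans t).dist ≤ (4 * D : ℝ≥0) ∧ ∀ U' ⊆ U,
        (∀ y ∈ U', ∀ c : (restrict G U).Walk t src, Follows (fun u => (ans u).pred) c →
          ∀ w ∈ c.support, ((ε * D / 2 : ℝ≥0) : ℝ≥0∞) < gdist G ℓ y w) →
        potential ℓ (4 * D) (ε * D / 2) Finset.univ Ls U' + 1 ≤
          potential ℓ (4 * D) (ε * D / 2) Finset.univ Ls U := by
  classical
  set B : Finset (Fin n) := (gball (restrict G U) ℓ v D).toFinset with hB
  have hBU : ∀ t ∈ B, t ∈ U ∧ (restrict G U).Reachable t src ∧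
      (ans t).dist ≤ (4 * D : ℝ≥0) := by
    intro t ht
    rw [hB, Set.mem_toFinset] at ht
    have ht' : gdist (restrict G U) ℓ v t ≤ D := ht
    -- Two legs of length `D` through `v`; the approximation factor turns `2D` into `4D`.
    have hts : gdist (restrict G U) ℓ t src ≤ (2 * D : ℝ≥0) := by
      refine (gdist_triangle t v src).trans ?_
      rw [gdist_comm t v]
      refine (add_le_add ht' hsrc).trans ?_
      rw [← ENNReal.coe_add, two_mul]
    have hne := ne_top_of_le_ne_top ENNReal.coe_ne_top hts
    refine ⟨?_, reachable_of_gdist_ne_top hne, ?_⟩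
    · obtain ⟨p⟩ := reachable_of_gdist_ne_top (ne_top_of_le_ne_top ENNReal.coe_ne_top ht')
      exact mem_of_restrict_walk p.reverse hv t p.reverse.start_mem_support
    · refine (hans.approx t (by rwa [setDist_singleton])).trans ?_
      rw [setDist_singleton]
      refine (mul_le_mul_right hts _).trans ?_
      rw [← ENNReal.coe_mul, ← mul_assoc]
      norm_num
  have hsrcU : src ∈ U := by
    have : src ∈ B := by rw [hB, Set.mem_toFinset]; exact hsrc
    exact (hBU src this).1
  -- Pointer walks are unique, so this is the node set of the tree path from `t`.
  set R : Fin n → Finset (Fin n) := fun t => Finset.univ.filter fun x =>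
    ∃ c : (restrict G U).Walk t src, Follows (fun u => (ans u).pred) c ∧ x ∈ c.support with hR
  obtain ⟨A, hAB, hcard, hdec⟩ := exists_decrease (G := G) (ℓ := ℓ) (r := 4 * D)
    (δ := ε * D / 2) (s := src) (U := U) (R := R) Ls Finset.univ B (by
      intro t ht
      obtain ⟨htU, hreach, hd⟩ := hBU t ht
      obtain ⟨c, hc, hlen⟩ := hans.exists_follows hreach
      have hRt : R t = c.support.toFinset := by
        ext x
        simp only [hR, Finset.mem_filter, Finset.mem_univ, true_and, List.mem_toFinset]
        constructor
        · rintro ⟨c', hc', hx⟩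
          rwa [hc'.support_eq hans.pred_source hc] at hx
        · exact fun hx => ⟨c, hc, hx⟩
      refine ⟨fun x hx => ?_, c.mapLe (restrict_le U), ?_, ?_⟩
      · rw [hRt, List.mem_toFinset] at hx
        simpa using mem_of_restrict_walk c hsrcU x hx
      · rw [hRt, SimpleGraph.Walk.support_mapLe_eq_support]
      · rw [wlen_mapLe]
        rw [hlen] at hd
        exact_mod_cast hd) (by simpa using hsep)
  refine ⟨A, ?_, fun t ht => ⟨(hBU t (hAB ht)).1, (hBU t (hAB ht)).2.2, fun U' hU' hfar =>
    hdec t ht U' hU' fun y hy x hx => ?_⟩⟩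
  · rw [Set.ncard_eq_toFinset_card', ← hB] at hheavy
    rw [Fintype.card_fin] at hcard
    have : 2 * (B.card : ℝ) ≤ 2 * A.card + n := by exact_mod_cast hcard
    linarith
  · simp only [hR, Finset.mem_filter, Finset.mem_univ, true_and] at hx
    obtain ⟨c, hc, hx⟩ := hx
    exact hfar y hy c hc x hx

/-- The configurations that do not describe a weak separator with at most `N` pieces. -/
def badSet (G : SimpleGraph (Fin n)) (ℓ : Sym2 (Fin n) → ℝ≥0) (D ε : ℝ≥0) (b N : ℕ) :
    Set (Fin n → NodeState n b) :=
  {s | ¬ ∃ S : List (Piece G), (∀ v, (s v).outs = S.map fun P => P.view v) ∧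
    IsWeakSeparator ℓ D ε S ∧ S.length ≤ N}

/-- Induction on the rounds with arbitrary history and configuration, so that adaptive answers are
covered. -/
lemma exec_separatorProgram_le (hb : b ≠ 0) (hn : n ≤ 2 ^ b) (hn' : 2 ^ b ≤ 2 * n)
    (hG : ∀ u v, G.Reachable u v) {z : Fin n} (hz : z.val = 0) {O : Oracle n (NodeState n b)}
    (hO : O.Correct G ℓ)
    (hsep : ∀ v ∈ layersRest Finset.univ Ls, 2 * {w | w ∈ layersRest Finset.univ Ls ∧
        (restrict G (layersRest Finset.univ Ls)).Reachable v w}.ncard ≤ n) (N T : ℕ) :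
    ∀ (hist : List (Fin n → NodeState n b)) (s : Fin n → NodeState n b) (S : List (Piece G)),
      Consistent s S → Carved ℓ D ε Finset.univ S → S.length + T ≤ N →
      (exec G O (separatorProgram n b D ε T) hist s).toOuterMeasure (badSet G ℓ D ε b N) ≤
        ENNReal.ofReal (failBound ℓ D ε Ls (piecesRest Finset.univ S) * (1 - 21 / 512) ^ T) := by
  classical
  induction T with
  | zero =>
    intro hist s S h hS hN
    rw [separatorProgram, exec, PMF.toOuterMeasure_pure_apply]
    split_ifs with hbad
    · have hheavy : Heavy G ℓ D (piecesRest Finset.univ S) := by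
        by_contra hlight
        refine hbad ⟨S, h.outs, ⟨hS, fun v hv => ?_⟩, by omega⟩
        rw [Fintype.card_fin]
        by_contra hlt
        exact hlight ⟨v, hv, not_le.1 hlt⟩
      rw [failBound, if_pos hheavy, pow_zero, mul_one, ENNReal.one_le_ofReal]
      exact one_le_pow₀ one_le_two
    · exact zero_le
  | succ T ih =>
    intro hist s S h hS hN
    have hx : (0 : ℝ) ≤ (1 - 21 / 512) ^ T := by positivity
    have hnR : (2 : ℝ) ^ b ≤ 2 * n := by exact_mod_cast hn'
    rw [separatorProgram, exec, PMF.toOuterMeasure_bind_apply]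
    have hrec : ∀ hist' s' (S' : List (Piece G)), Consistent s' S' →
        Carved ℓ D ε Finset.univ S' → S'.length ≤ S.length + 1 →
        (exec G O (separatorProgram n b D ε T) hist' s').toOuterMeasure (badSet G ℓ D ε b N) ≤
        ENNReal.ofReal (failBound ℓ D ε Ls (piecesRest Finset.univ S') * (1 - 21 / 512) ^ T) :=
      fun hist' s' S' h1 h2 h3 => ih hist' s' S' h1 h2 (by omega)
    have hstep : ∀ r : Fin n → Msg b, Consistent (fun v => { s v with coins := r v }) S :=
      fun r => ⟨h.id, h.alive, h.outs⟩
    have hfirst := fun r => exec_first_half hG hz hO (hstep r)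
      (.compute (fun st r => { st with coins := r }) ::
        .aggregate (fullSpec n _) NodeState.speak (maxAgg b) (fun st m => { st with dst := m }) ::
        .ssp (treeSpec n b) NodeState.isDst (fun st a => { st with toDst := a }) ::
        .aggregate (fullSpec n _) (NodeState.report D) (maxAgg b)
          (fun st m => { st with ok := decide (m ≠ ⊥) }) ::
        .ssp (fullSpec n _) NodeState.onPath (NodeState.finish (ε * D)) ::
        separatorProgram n b D ε T) (s :: hist)
    obtain ⟨β, B, hβ, hheavy, hB⟩ : ∃ (β : ℝ) (B : Finset (Fin n)), β * 2 ^ b ≤ B.card ∧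
        (Heavy G ℓ D (piecesRest Finset.univ S) → β = 7 / 16) ∧
        ∀ src ∈ B, ∃ v ∈ piecesRest Finset.univ S,
          7 / 8 * (n : ℝ) < ((gball (restrict G (piecesRest Finset.univ S)) ℓ v D).ncard : ℝ) ∧
          src ∈ gball (restrict G (piecesRest Finset.univ S)) ℓ v D := by
      by_cases hheavy : Heavy G ℓ D (piecesRest Finset.univ S)
      · obtain ⟨v, hv, hlt⟩ := hheavy
        -- More than `7n/8` good sources among at most `2n` messages.
        refine ⟨7 / 16, (gball (restrict G (piecesRest Finset.univ S)) ℓ v D).toFinset, ?_,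
          fun _ => rfl, fun src hsrc => ⟨v, hv, hlt, by simpa using hsrc⟩⟩
        rw [← Set.ncard_eq_toFinset_card']
        linarith
      · exact ⟨0, ∅, by simp, fun h => absurd h hheavy, by simp⟩
    refine (tsum_uniform_le z _ (idMsgs hn B) (K := failBound ℓ D ε Ls
      (piecesRest Finset.univ S) * (1 - 21 / 512) ^ T) (x := 1 - 3 / 16 * (1 - 1 / 2)) (β := β)
      (mul_nonneg (failBound_nonneg _) hx) (by norm_num) (by norm_num)
      (by rwa [idMsgs, Finset.card_map]) (fun r => ?_) (fun r hr => ?_)).trans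
      (ENNReal.ofReal_le_ofReal ?_)
    · obtain ⟨hist', s', hex, hs'⟩ := hfirst r
      rw [hex]
      have := exec_second_le hb hn hG hz hO hs' hS _ hist' _ hx hrec (β := 0) (A := ∅)
        (by simp) (by simp)
      simpa using this
    · obtain ⟨src, hsrcB, hsrcm⟩ := mem_idMsgs.1 hr
      obtain ⟨v, hv, hlt, hsrc⟩ := hB src hsrcB
      obtain ⟨hist', s', hex, hs'⟩ := hfirst r
      rw [hex]
      have hans := hs'.answer
      have hsrcU : src ∈ piecesRest Finset.univ S := by
        obtain ⟨p⟩ := reachable_of_gdist_ne_top (ne_top_of_le_ne_top ENNReal.coe_ne_top hsrc)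
        exact mem_of_restrict_walk p.reverse hv src p.reverse.start_mem_support
      have hset : (Finset.univ.filter fun w : Fin n =>
          w ∈ piecesRest Finset.univ S ∧ w.val = (r z).val) = {src} := by
        ext w
        simp only [Finset.mem_filter, Finset.mem_univ, true_and, Finset.mem_singleton]
        exact ⟨fun hw => Fin.ext (hw.2.trans hsrcm.symm), fun hw => hw ▸ ⟨hsrcU, hsrcm⟩⟩
      rw [hset] at hans
      obtain ⟨A, hA, hA'⟩ := exists_targets (ε := ε) hsep hv hlt hsrc hans
      refine exec_second_le hb hn hG hz hO hs' hS _ hist' _ hx hrec (A := A) ?_ ?_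
      · linarith
      · intro t ht
        obtain ⟨h1, h2, h3⟩ := hA' t ht
        exact ⟨h1, h2, src, hsrcm, h3⟩
    · by_cases hU : Heavy G ℓ D (piecesRest Finset.univ S)
      · rw [hheavy hU, pow_succ]
        exact le_of_eq (by ring)
      · simp [failBound, hU]

end Failure

/-! ## The main theorem -/

section Main

variable {n k : ℕ} {G : SimpleGraph (Fin n)} {ℓ : Sym2 (Fin n) → ℝ≥0} {D ε : ℝ≥0}

lemma reachable_of_wdiam_lt (h : wdiam G ℓ < D) (u v : Fin n) : G.Reachable u v :=
  reachable_of_gdist_ne_top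
    (ne_top_of_lt ((le_iSup₂ (f := fun u v => gdist G ℓ u v) u v).trans_lt h))

lemma IsPathSeparable.exists_separator (h : IsPathSeparable G ℓ k) :
    ∃ Ls, IsPathSeparator G ℓ k Finset.univ Ls := by
  cases h with
  | last _ Ls sep _ => exact ⟨Ls, sep⟩
  | step _ Ls sep _ => exact ⟨Ls, sep⟩

lemma layersRest_eq_self {V : Type*} [DecidableEq V] {G : SimpleGraph V}
    {Ls : List (List (GWalk G))} : ∀ U : Finset V, (Ls.map List.length).sum = 0 →
      layersRest U Ls = U := by
  induction Ls with
  | nil => exact fun U _ => rfl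
  | cons L Ls ih =>
    intro U h
    rw [List.map_cons, List.sum_cons, Nat.add_eq_zero_iff, List.length_eq_zero_iff] at h
    obtain ⟨rfl, h⟩ := h
    rw [layersRest, ih _ h]
    simp [layerVerts]

/-- A nonempty connected graph has no empty path separator. -/
lemma IsPathSeparable.pos (h : IsPathSeparable G ℓ k) (hG : ∀ u v, G.Reachable u v)
    (hn : n ≠ 0) : k ≠ 0 := by
  rintro rfl
  obtain ⟨Ls, hL⟩ := h.exists_separator
  have hrest := layersRest_eq_self Finset.univ (Nat.le_zero.1 hL.card_le)
  have := hL.component ⟨0, Nat.pos_of_ne_zero hn⟩ (by rw [hrest]; exact Finset.mem_univ _)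
  -- Nothing is removed, so the single component has `n` nodes and `2n ≤ n`.
  rw [hrest] at this
  have hres : restrict G Finset.univ = G := by ext; simp [restrict]
  simp only [hres, hG, Finset.mem_univ, and_self, Set.ofPred_true, Set.ncard_univ,
    Nat.card_eq_fintype_card, Fintype.card_fin, Finset.card_univ] at this
  omega

/-- The algorithm for large `ε`: a single piece contains all nodes. -/
def trivialAlgorithm (n : ℕ) : Algorithm n 0 where
  State := Fin n
  start v _ := v
  program := []
  output v := [⟨decide (v.val = 0), none, true⟩]

/-- The diameter is below `D ≤ εD`, so the ball around node `0` may be everything. -/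
lemma trivialAlgorithm_outputs (hn : n ≠ 0) (hε : 1 ≤ ε) (hD : wdiam G ℓ < D) :
    ∃ S : List (Piece G), (trivialAlgorithm n).Outputs
      ((trivialAlgorithm n).initial G ℓ) S ∧ IsWeakSeparator ℓ D ε S ∧ S.length = 1 := by
  set z : Fin n := ⟨0, Nat.pos_of_ne_zero hn⟩ with hz
  refine ⟨[⟨⟨z, z, .nil⟩, Finset.univ⟩], ?_, ⟨⟨⟨.nil, by simp, ?_⟩, ?_, ?_, trivial⟩, ?_⟩, rfl⟩
  · intro v
    simp [trivialAlgorithm, Algorithm.initial, Piece.view, hz, Fin.ext_iff]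
  · simp [wlen_nil]
  · simp [wlen_nil]
  · intro w _
    refine (setDist_le (s := z) (by simp [GWalk.verts])).trans ?_
    refine (le_iSup₂ (f := fun u v => gdist G ℓ u v) w z).trans (hD.le.trans ?_)
    exact_mod_cast le_mul_of_one_le_left zero_le hε
  · intro v hv
    simp [piecesRest] at hv

lemma exp_bound {c Φ T L : ℝ} (h : Φ + c * L ≤ 21 / 512 * T) :
    Real.exp Φ * Real.exp (-(21 / 512) * T) ≤ Real.exp (-c * L) := by
  rw [← Real.exp_add, Real.exp_le_exp]
  linarith

lemma failBound_univ_le {Ls : List (List (GWalk G))} {c : ℝ} (hL : IsPathSeparator G ℓ k .univ Ls)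
    (hD : 0 < D) (hε : 0 < ε) (hε1 : ε < 1) (hn : n ≠ 0) {T : ℕ}
    (hT : 25 * (33 * ((ε : ℝ)⁻¹ * k) + c * Real.log n) ≤ T) (hc : 0 ≤ c) :
    failBound ℓ D ε Ls Finset.univ * (1 - 21 / 512) ^ T ≤ (n : ℝ) ^ (-c) := by
  have hδ : 0 < ε * D / 2 := by positivity
  have hDR : (0 : ℝ) < D := by exact_mod_cast hD
  have hεR : (0 : ℝ) < ε := by exact_mod_cast hε
  have hε1R : (ε : ℝ) < 1 := by exact_mod_cast hε1
  have hnR : (0 : ℝ) < n := by exact_mod_cast Nat.pos_of_ne_zero hn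
  have hlog : 0 ≤ Real.log n := Real.log_natCast_nonneg n
  set Φ := potential ℓ (4 * D) (ε * D / 2) Finset.univ Ls Finset.univ with hΦ
  have hpot : (Φ : ℝ) ≤ 33 * ((ε : ℝ)⁻¹ * k) := by
    have h1 := potential_le (r := 4 * D) hδ Ls Finset.univ Finset.univ hL.shortest
    -- The relevant radius is `4D` and the packing scale `εD/2`; rounding up turns 32 into 33, as `ε
    -- < 1`.
    have h2 : (4 * ((4 * D : ℝ≥0) : ℝ) / ((ε * D / 2 : ℝ≥0) : ℝ)) = 32 * (ε : ℝ)⁻¹ := by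
      push_cast
      field_simp
      norm_num
    rw [h2] at h1
    have h3 : (⌊32 * (ε : ℝ)⁻¹⌋₊ : ℝ) ≤ 32 * (ε : ℝ)⁻¹ := Nat.floor_le (by positivity)
    have h4 : 1 ≤ (ε : ℝ)⁻¹ := (one_le_inv₀ hεR).2 hε1R.le
    calc (Φ : ℝ) ≤ ((k * (⌊32 * (ε : ℝ)⁻¹⌋₊ + 1) : ℕ) : ℝ) := by
          exact_mod_cast h1.trans (Nat.mul_le_mul_right _ hL.card_le)
      _ = k * (⌊32 * (ε : ℝ)⁻¹⌋₊ + 1) := by push_cast; ring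
      _ ≤ k * (33 * (ε : ℝ)⁻¹) := by gcongr; linarith
      _ = _ := by ring
  have hfail : failBound ℓ D ε Ls Finset.univ ≤ Real.exp Φ := by
    unfold failBound
    split_ifs
    · rw [← hΦ, ← mul_one (Φ : ℝ), Real.exp_nat_mul]
      have := Real.add_one_le_exp (1 : ℝ)
      exact pow_le_pow_left₀ (by norm_num) (by linarith) _
    · exact (Real.exp_pos _).le
  have hq : (1 - 21 / 512 : ℝ) ^ T ≤ Real.exp (-(21 / 512) * T) := by
    rw [mul_comm, Real.exp_nat_mul]
    have := Real.add_one_le_exp (-(21 / 512) : ℝ)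
    exact pow_le_pow_left₀ (by norm_num) (by linarith) _
  calc _ ≤ Real.exp Φ * Real.exp (-(21 / 512) * T) :=
        mul_le_mul hfail hq (by positivity) (Real.exp_pos _).le
    _ ≤ Real.exp (-c * Real.log n) := by
        apply exp_bound
        have : 0 ≤ c * Real.log n := mul_nonneg hc hlog
        have : (0 : ℝ) ≤ Φ := by positivity
        -- Uses `25 · 21/512 > 1`.
        linarith
    _ = (n : ℝ) ^ (-c) := by rw [Real.rpow_def_of_pos hnR, mul_comm]

/-- For `ε < 1`, sufficiently many rounds succeed with high probability. -/
lemma separatorAlgorithm_success {c : ℝ} (hc : 0 ≤ c) (hn : 2 ≤ n) (hε : 0 < ε) (hε1 : ε < 1)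
    {T : ℕ} (hT : 25 * (33 * ((ε : ℝ)⁻¹ * k) + c * Real.log n) ≤ T)
    (hsep : IsPathSeparable G ℓ k) (hdiam : wdiam G ℓ < D)
    {O : Oracle n (separatorAlgorithm n (Nat.clog 2 n) D ε T).State} (hO : O.Correct G ℓ) :
    1 - (n : ℝ) ^ (-c) ≤
      (((separatorAlgorithm n (Nat.clog 2 n) D ε T).run G ℓ O).toOuterMeasure
        {s | ∃ S : List (Piece G), (separatorAlgorithm n (Nat.clog 2 n) D ε T).Outputs s S ∧
          IsWeakSeparator ℓ D ε S ∧ S.length ≤ T}).toReal := by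
  have hG := reachable_of_wdiam_lt hdiam
  obtain ⟨Ls, hL⟩ := hsep.exists_separator
  set μ := (separatorAlgorithm n (Nat.clog 2 n) D ε T).run G ℓ O with hμ
  have hb : Nat.clog 2 n ≠ 0 := (Nat.clog_pos one_lt_two hn).ne'
  have hpow : n ≤ 2 ^ Nat.clog 2 n := Nat.le_pow_clog one_lt_two n
  have hpow' : 2 ^ Nat.clog 2 n ≤ 2 * n := by
    have := Nat.pow_pred_clog_lt_self one_lt_two hn
    rw [← Nat.succ_pred_eq_of_ne_zero hb, pow_succ]
    omega
  have hD : 0 < D := by exact_mod_cast zero_le.trans_lt hdiam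
  have hbad : μ.toOuterMeasure (badSet G ℓ D ε (Nat.clog 2 n) T) ≤
      ENNReal.ofReal ((n : ℝ) ^ (-c)) := by
    refine (exec_separatorProgram_le (S := []) (Ls := Ls) hb hpow hpow' hG
      (z := ⟨0, by omega⟩) rfl hO (by simpa using hL.component) T T [] ((separatorAlgorithm n (Nat.clog 2 n) D ε T).initial G ℓ)
      ⟨fun v => rfl, fun v => by simp [separatorAlgorithm, Algorithm.initial, piecesRest],
        fun v => rfl⟩ trivial (by simp)).trans (ENNReal.ofReal_le_ofReal ?_)
    exact failBound_univ_le hL hD hε hε1 (by omega) hT hc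
  set good := {s | ∃ S : List (Piece G),
    (separatorAlgorithm n (Nat.clog 2 n) D ε T).Outputs s S ∧
      IsWeakSeparator ℓ D ε S ∧ S.length ≤ T}
  -- Good and bad configurations together are everything.
  have hone : 1 ≤ μ.toOuterMeasure good +
      μ.toOuterMeasure (badSet G ℓ D ε (Nat.clog 2 n) T) := by
    refine le_trans (le_of_eq ?_) (MeasureTheory.measure_union_le _ _)
    symm
    rw [PMF.toOuterMeasure_apply_eq_one_iff]
    exact fun s _ => Classical.em (s ∈ good)
  have hle : μ.toOuterMeasure good ≤ 1 := by
    rw [← (PMF.toOuterMeasure_apply_eq_one_iff (p := μ) (s := Set.univ)).2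
      (Set.subset_univ _)]
    exact MeasureTheory.measure_mono (Set.subset_univ _)
  have h0 : (0 : ℝ) ≤ (n : ℝ) ^ (-c) := by positivity
  have := ENNReal.toReal_mono (ENNReal.add_ne_top.2
    ⟨ne_top_of_le_ne_top ENNReal.one_ne_top hle, ENNReal.ofReal_ne_top⟩)
    (hone.trans (add_le_add le_rfl hbad))
  rw [ENNReal.toReal_one, ENNReal.toReal_add (ne_top_of_le_ne_top ENNReal.one_ne_top hle)
    ENNReal.ofReal_ne_top, ENNReal.toReal_ofReal h0] at this
  linarith

/-! ### Arithmetic of the constants. -/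

lemma clog_le (hn : 2 ≤ n) : (Nat.clog 2 n : ℝ) ≤ 4 * Real.log n := by
  have hlt : (2 : ℝ) ^ (Nat.clog 2 n).pred < n := by
    exact_mod_cast Nat.pow_pred_clog_lt_self one_lt_two hn
  have h1 := Real.log_lt_log (by positivity) hlt
  rw [Real.log_pow] at h1
  have h2 : Real.log 2 ≤ Real.log n := Real.log_le_log two_pos (by exact_mod_cast hn)
  have h3 := Real.log_two_gt_d9
  have h4 : (Nat.clog 2 n : ℝ) = (Nat.clog 2 n).pred + 1 := by
    exact_mod_cast (Nat.succ_pred_eq_of_ne_zero (Nat.clog_pos one_lt_two hn).ne').symm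
  have h5 : (0 : ℝ) ≤ (Nat.clog 2 n).pred := by positivity
  nlinarith

/-- Since `log n > 1/2`, the term `k/ε` costs a factor 2: `25 · 33 · 2 = 1650`, and rounding up adds
1. -/
lemma rounds_le {c : ℝ} (hc : 0 ≤ c) (hn : 2 ≤ n) (hk : k ≠ 0) (hε : 0 < ε) (hε1 : ε < 1) :
    ((⌈25 * (33 * ((ε : ℝ)⁻¹ * k) + c * Real.log n)⌉₊ : ℕ) : ℝ) ≤
      (1651 + 25 * c) * max 1 ((ε : ℝ)⁻¹ * k * Real.log n) := by
  have hεR : (0 : ℝ) < ε := by exact_mod_cast hε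
  have hε1R : (ε : ℝ) < 1 := by exact_mod_cast hε1
  have hk1 : (1 : ℝ) ≤ k := by exact_mod_cast Nat.one_le_iff_ne_zero.2 hk
  have hε' : 1 ≤ (ε : ℝ)⁻¹ := (one_le_inv₀ hεR).2 hε1R.le
  have hlog : Real.log 2 ≤ Real.log n := Real.log_le_log two_pos (by exact_mod_cast hn)
  have h2 := Real.log_two_gt_d9
  set a : ℝ := (ε : ℝ)⁻¹ * k with ha
  have ha1 : 1 ≤ a := by nlinarith
  set X := max 1 (a * Real.log n) with hX
  have hX1 : 1 ≤ X := le_max_left _ _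
  have hX2 : a * Real.log n ≤ X := le_max_right _ _
  have h3 : a ≤ 2 * X := by nlinarith
  have h4 : c * Real.log n ≤ c * X := by
    refine mul_le_mul_of_nonneg_left ?_ hc
    nlinarith
  have h5 : 0 ≤ 25 * (33 * a + c * Real.log n) := by
    have : 0 ≤ c * Real.log n := mul_nonneg hc (by linarith)
    linarith
  have h6 := Nat.ceil_lt_add_one h5
  linarith

end Main

end WeakSep

end

theorem mainTheorem3 (c : ℝ) (hc : 0 < c) :
    ∃ C : ℝ, 0 < C ∧ ∀ (n k : ℕ) (D ε : ℝ≥0), 0 < ε →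
      ∃ (b : ℕ) (A : WeakSep.Algorithm n b),
        (b : ℝ) ≤ C * Real.log n ∧
        (A.program.countP WeakSep.Instr.isAggregate : ℝ) ≤
          C * max 1 ((ε : ℝ)⁻¹ * k * Real.log n) ∧
        (A.program.countP WeakSep.Instr.isSSP : ℝ) ≤
          C * max 1 ((ε : ℝ)⁻¹ * k * Real.log n) ∧
        ∀ (G : SimpleGraph (Fin n)) (ℓ : Sym2 (Fin n) → ℝ≥0),
          WeakSep.IsPathSeparable G ℓ k → WeakSep.wdiam G ℓ < D →
          ∀ O : WeakSep.Oracle n A.State, O.Correct G ℓ →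
            1 - (n : ℝ) ^ (-c) ≤
              ((A.run G ℓ O).toOuterMeasure
                {s | ∃ S : List (WeakSep.Piece G), A.Outputs s S ∧
                  WeakSep.IsWeakSeparator ℓ D ε S ∧
                  (S.length : ℝ) ≤ C * max 1 ((ε : ℝ)⁻¹ * k * Real.log n)}).toReal := by
  -- Each round uses three aggregations and three shortest path computations.
  refine ⟨3 * (1651 + 25 * c), by positivity, fun n k D ε hε => ?_⟩
  set X := max 1 ((ε : ℝ)⁻¹ * k * Real.log n) with hX
  have hX1 : 1 ≤ X := le_max_left _ _
  have hCX : 1 ≤ 3 * (1651 + 25 * c) * X := by nlinarith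
  have hlog : 0 ≤ Real.log n := Real.log_natCast_nonneg n
  have hzero : ((0 : ℕ) : ℝ) ≤ 3 * (1651 + 25 * c) * Real.log n := by
    rw [Nat.cast_zero]; positivity
  by_cases hn0 : n = 0
  · subst hn0
    refine ⟨0, WeakSep.trivialAlgorithm 0, hzero, (by simp [WeakSep.trivialAlgorithm]; linarith),
      (by simp [WeakSep.trivialAlgorithm]; linarith), fun G ℓ _ _ O _ => ?_⟩
    rw [(PMF.toOuterMeasure_apply_eq_one_iff _ _).2]
    · simp [Real.rpow_nonneg]
    · exact fun s _ => ⟨[], fun v => v.elim0, ⟨trivial, fun v => v.elim0⟩, by simp; linarith⟩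
  -- For `n = 1` the required probability is 0, and for `k = 0` no graph qualifies.
  by_cases htriv : n = 1 ∨ k = 0 ∨ 1 ≤ ε
  · refine ⟨0, WeakSep.trivialAlgorithm n, hzero, (by simp [WeakSep.trivialAlgorithm]; linarith),
      (by simp [WeakSep.trivialAlgorithm]; linarith), fun G ℓ hsep hdiam O _ => ?_⟩
    rcases htriv with rfl | rfl | hε1
    · simp
    · exact absurd rfl (hsep.pos (WeakSep.reachable_of_wdiam_lt hdiam) hn0)
    · obtain ⟨S, h1, h2, h3⟩ := WeakSep.trivialAlgorithm_outputs hn0 hε1 hdiam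
      have hmem : (WeakSep.trivialAlgorithm n).initial G ℓ ∈
          {s | ∃ S : List (WeakSep.Piece G), (WeakSep.trivialAlgorithm n).Outputs s S ∧
            WeakSep.IsWeakSeparator ℓ D ε S ∧
            (S.length : ℝ) ≤ 3 * (1651 + 25 * c) * X} :=
        ⟨S, h1, h2, by rw [h3]; simpa using hCX⟩
      have hrun : (WeakSep.trivialAlgorithm n).run G ℓ O =
          PMF.pure ((WeakSep.trivialAlgorithm n).initial G ℓ) := rfl
      classical
      rw [hrun, PMF.toOuterMeasure_pure_apply, if_pos hmem, ENNReal.toReal_one]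
      have : (0 : ℝ) ≤ (n : ℝ) ^ (-c) := by positivity
      linarith
  · push Not at htriv
    obtain ⟨hn1, hk, hε1⟩ := htriv
    have hn : 2 ≤ n := by omega
    set T := ⌈25 * (33 * ((ε : ℝ)⁻¹ * k) + c * Real.log n)⌉₊ with hT
    have hTX : (T : ℝ) ≤ (1651 + 25 * c) * X := WeakSep.rounds_le hc.le hn hk hε hε1
    refine ⟨Nat.clog 2 n, WeakSep.separatorAlgorithm n (Nat.clog 2 n) D ε T, ?_, ?_, ?_,
      fun G ℓ hsep hdiam O hO => ?_⟩
    · have := WeakSep.clog_le hn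
      nlinarith [mul_nonneg hc.le hlog]
    · rw [WeakSep.separatorAlgorithm_countP_isAggregate]
      push_cast
      linarith
    · rw [WeakSep.separatorAlgorithm_countP_isSSP]
      push_cast
      linarith
    · refine (WeakSep.separatorAlgorithm_success hc.le hn hε hε1 (Nat.le_ceil _) hsep hdiam
        hO).trans (ENNReal.toReal_mono ?_ (MeasureTheory.measure_mono ?_))
      · refine ne_top_of_le_ne_top ENNReal.one_ne_top ?_
        rw [← (PMF.toOuterMeasure_apply_eq_one_iff (p := (WeakSep.separatorAlgorithm n
          (Nat.clog 2 n) D ε T).run G ℓ O) (s := Set.univ)).2 (Set.subset_univ _)]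
        exact MeasureTheory.measure_mono (Set.subset_univ _)
      · rintro s ⟨S, h1, h2, h3⟩
        refine ⟨S, h1, h2, ?_⟩
        have : (S.length : ℝ) ≤ T := by exact_mod_cast h3
        have : (0 : ℝ) ≤ T := by positivity
        linarith
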